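/- Let $K$ be a field. **Definitions.** A *Bergman presentation* $(X,R)$ consists of a finite set $X$ of generators and a finite family $R=\{a_i=b_i\mid i\in I\}$ of relations between nonzero elements $a_i,b_i$ of the free abelian monoid $\langle X\rangle$, together with a partition $I=I_{\mathrm{blue}}\sqcup I_{\mathrm{red}}$ such that: for each $i\in I_{\mathrm{blue}}$ one has $b_i=\sum_{x\in X_i}x$ for a subset $X_i\subseteq X$ with $|X_i|\ge 2$, these $X_i$ being pairwise disjoint; and, with $X_{\mathrm{base}}=X\setminus\bigcup_{i\in I_{\mathrm{blue}}}X_i$, the blue indices can be ordered $i_1,\dots,i_m$ so that $a_{i_k}\in\langle X_{\mathrm{base}}\cup X_{i_1}\cup\dots\cup X_{i_{k-1}}\rangle$ for all $k$. It is *basic* if $X=X_{\mathrm{base}}$. Its *Bergman algebra* $B(X,R)$ is the unital $K$-algebra generated by the entries of square matrices $\epsilon_x$ ($x\in X$) and of matrices $\sigma_i$, $\sigma'_i$ ($i\in I_{\mathrm{red}}$), subject to the relations below. Here $\epsilon_c=\epsilon_{x_1}\oplus\dots\oplus\epsilon_{x_n}$ for $c=x_1+\dots+x_n$; $\epsilon_x$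 is a $1\times1$ matrix if $x\in X_{\mathrm{base}}$, and has the size of $\epsilon_{a_i}$ if $x\in X_i$; $\sigma_i$ has size $|\epsilon_{a_i}|\times|\epsilon_{b_i}|$ and $\sigma'_i$ has size $|\epsilon_{b_i}|\times|\epsilon_{a_i}|$. The relations are: (1) the $\epsilon_x$ with $x\in X_{\mathrm{base}}$ are orthogonal idempotents with sum $1$; (2) for $i\in I_{\mathrm{blue}}$, the $\epsilon_x$ with $x\in X_i$ are orthogonal idempotents with $\epsilon_{a_i}\epsilon_x\epsilon_{a_i}=\epsilon_x$ and sum $\epsilon_{a_i}$; (3) for $i\in I_{\mathrm{red}}$, $\epsilon_{a_i}\sigma_i\epsilon_{b_i}=\sigma_i$, $\epsilon_{b_i}\sigma'_i\epsilon_{a_i}=\sigma'_i$, $\sigma_i\sigma'_i=\epsilon_{a_i}$ and $\sigma'_i\sigma_i=\epsilon_{b_i}$. A *Bergman graph* $H$ is the same datum written as a finite hypergraph: a finite set $H^0$ of vertices, a finite set $H^1$ of hyperedges, maps $s,r$ assigning to each hyperedge a nonempty multiset over $H^0$, and a set of blue hyperedges, such that setting $X=H^0$, $I=H^1$, $a_h=\sum_v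 s(h)(v)v$ and $b_h=\sum_v r(h)(v)v$ gives a Bergman presentation $\beta(H)$; put $B(H)=B(\beta(H))$, and call $H$ basic if $\beta(H)$ is basic. *Insplitting (presentations).* Let $(X,R)$ be basic, and let $x_1\in X$ and $i\in I$ be such that $a_i=x_1$ and $x_1$ is not a summand of $a_j$ for any $j\ne i$. Let $n_j$ be the multiplicity of $x_1$ in $b_j$, suppose that $S=\{(j,k)\mid j\in I,\ 1\le k\le n_j\}$ is nonempty, let $S=S_1\sqcup\dots\sqcup S_t$ be a partition into nonempty subsets, and put $\phi(j,k)=p$ if $(j,k)\in S_p$. For $j\in I$ let $b'_j$ be obtained from $b_j$ by replacing the summand $n_jx_1$ by $x_{\phi(j,1)}+\dots+x_{\phi(j,n_j)}$. The basic Bergman presentation $(X',R')$ with $X'=X\sqcup\{x_2,\dots,x_t\}$ and with the relations $a_j=b'_j$ ($j\in I\setminus\{i\}$) and $x_p=b'_i$ ($1\le p\le t$) is said to be obtained from $(X,R)$ by insplitting. *Insplitting (graphs).* Let $H$ be basic, and let $v_1\in H^0$ and $h_1\in H^1$ be such that $s(h_1)=\{v_1\}$ and $v_1$ is not a source of any $g\ne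 h_1$. Suppose that $S=\{(g,k)\mid g\in H^1,\ 1\le k\le r(g)(v_1)\}$ is nonempty, let $S=S_1\sqcup\dots\sqcup S_t$ be a partition into nonempty subsets, and put $\phi(g,k)=p$ if $(g,k)\in S_p$. The basic Bergman graph $H'$ obtained by adding vertices $v_2,\dots,v_t$ and hyperedges $h_2,\dots,h_t$ and replacing $s,r$ by $s',r'$, where for $g\in H^1\setminus\{h_1\}$, $u\in H^0\setminus\{v_1\}$ and $1\le p,q\le t$ $$s'(g)=s(g),\quad r'(g)(u)=r(g)(u),\quad r'(g)(v_q)=\#\{k\mid \phi(g,k)=q\},$$ $$s'(h_p)=\{v_p\},\quad r'(h_p)(u)=r(h_1)(u),\quad r'(h_p)(v_q)=\#\{k\mid\phi(h_1,k)=q\},$$ is said to be obtained from $H$ by insplitting. **Theorem.** (a) If $(X,R)$ is a basic Bergman presentation and $(X',R')$ can be obtained from $(X,R)$ by insplitting, then $B(X',R')$ and $B(X,R)$ are Morita equivalent; (b) if $H$ is a basic Bergman graph and $H'$ can be obtained from $H$ by insplitting, then $B(H')$ and $B(H)$ are Morita equivalent. In both cases there is a $K$-linear equivalence between the module categories. 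-/

import Mathlib

universe u v w

/-- A Bergman presentation `(X, R)` with `R = {a i = b i | i ∈ I}`. The free abelian monoid on `X`
is `Multiset X`; the family is finite (`X` and `I` are finite) and good (no `a i`, `b i` is zero).
`blue` is the set of blue indices, its complement is the set of red ones. For a blue `i`, the
condition `b i = ∑ x ∈ X_i, x` for a set `X_i` with at least two elements says that the multiset
`b i` has no repetitions and has at least two elements. -/
structure BergmanPresentation (X : Type u) (I : Type v) where
  a : I → Multiset X
  b : I → Multiset X
  finite_generators : Finite X
  finite_relations : Finite I
  a_ne_zero : ∀ i, a i ≠ 0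
  b_ne_zero : ∀ i, b i ≠ 0
  blue : Set I
  blue_nodup : ∀ i ∈ blue, (b i).Nodup
  blue_two_le : ∀ i ∈ blue, 2 ≤ (b i).card
  blue_disjoint : ∀ i ∈ blue, ∀ j ∈ blue, i ≠ j → ∀ x ∈ b i, x ∉ b j
  /-- There is an admissible ordering `e 0, e 1, …` of the blue indices: every summand of
  `a (e k)` is a base generator or lies in some `X_{e p}` with `p < k`. -/
  admissible : ∃ (m : ℕ) (e : Fin m ≃ blue), ∀ k, ∀ y ∈ a (e k),
    (∀ i ∈ blue, y ∉ b i) ∨ ∃ p < k, y ∈ b (e p)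

/-- A Bergman graph: a finite hypergraph with vertex set `V` and hyperedge set `E`, whose sources
and ranges are nonempty multisets (multiplicity functions `V → ℕ`), with its blue hyperedges. -/
structure BergmanGraph (V : Type u) (E : Type v) where
  s : E → V → ℕ
  r : E → V → ℕ
  finite_vertices : Finite V
  finite_edges : Finite E
  s_ne_zero : ∀ h, s h ≠ 0
  r_ne_zero : ∀ h, r h ≠ 0
  blue : Set E
  blue_set : ∀ h ∈ blue, ∀ v, r h v ≤ 1
  blue_two_le : ∀ h ∈ blue, 2 ≤ (Function.support (r h)).ncard
  blue_disjoint : ∀ g ∈ blue, ∀ h ∈ blue, g ≠ h →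
    Disjoint (Function.support (r g)) (Function.support (r h))
  admissible : ∃ (m : ℕ) (e : Fin m ≃ blue), ∀ k, ∀ v ∈ Function.support (s (e k)),
    (∀ h ∈ blue, v ∉ Function.support (r h)) ∨ ∃ p < k, v ∈ Function.support (r (e p))

noncomputable section

open Classical in
/-- The element `∑ v, m v • v` of the free abelian monoid on `V`. -/
def formalSum {V : Type u} [Finite V] (m : V → ℕ) : Multiset V :=
  letI := Fintype.ofFinite V
  ∑ v, m v • ({v} : Multiset V)

open Classical in
theorem count_formalSum {V : Type u} [Finite V] (m : V → ℕ) (v : V) :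
    (formalSum m).count v = m v := by
  simp [formalSum, Multiset.count_sum', Multiset.count_singleton]

theorem mem_formalSum {V : Type u} [Finite V] (m : V → ℕ) (v : V) :
    v ∈ formalSum m ↔ v ∈ Function.support m := by
  classical
  rw [← Multiset.count_pos, count_formalSum, Function.mem_support, Nat.pos_iff_ne_zero]

theorem formalSum_ne_zero {V : Type u} [Finite V] {m : V → ℕ} (hm : m ≠ 0) :
    formalSum m ≠ 0 := by
  obtain ⟨v, hv⟩ := Function.ne_iff.mp hm
  intro h
  have := (mem_formalSum m v).2 hv
  simp [h] at this

theorem formalSum_nodup {V : Type u} [Finite V] {m : V → ℕ} (hm : ∀ v, m v ≤ 1) :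
    (formalSum m).Nodup := by
  classical
  rw [Multiset.nodup_iff_count_le_one]
  intro v
  rw [count_formalSum]
  exact hm v

theorem ncard_support_le_card_formalSum {V : Type u} [Finite V] (m : V → ℕ) :
    (Function.support m).ncard ≤ (formalSum m).card := by
  classical
  have h : Function.support m = ((formalSum m).toFinset : Set V) := by
    ext v
    simp only [Finset.mem_coe, Multiset.mem_toFinset, mem_formalSum]
  rw [h, Set.ncard_coe_finset]
  exact Multiset.toFinset_card_le _

namespace BergmanGraph

variable {V : Type u} {E : Type v}

/-- A vertex that is not a range of a blue hyperedge. -/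
def IsBaseVertex (H : BergmanGraph V E) (v : V) : Prop :=
  ∀ h ∈ H.blue, v ∉ Function.support (H.r h)

/-- A Bergman graph is basic if all its vertices are base vertices. -/
def IsBasic (H : BergmanGraph V E) : Prop :=
  ∀ v, H.IsBaseVertex v

/-- The Bergman presentation that corresponds to a Bergman graph. -/
def toPresentation (H : BergmanGraph V E) : BergmanPresentation V E :=
  haveI := H.finite_vertices
  { a := fun h => formalSum (H.s h)
    b := fun h => formalSum (H.r h)
    finite_generators := H.finite_vertices
    finite_relations := H.finite_edges
    a_ne_zero := fun h => formalSum_ne_zero (H.s_ne_zero h)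
    b_ne_zero := fun h => formalSum_ne_zero (H.r_ne_zero h)
    blue := H.blue
    blue_nodup := fun h hh => formalSum_nodup (H.blue_set h hh)
    blue_two_le := fun h hh => (H.blue_two_le h hh).trans (ncard_support_le_card_formalSum _)
    blue_disjoint := by
      intro g hg h hh hne x hx hx'
      rw [mem_formalSum] at hx hx'
      exact Set.disjoint_left.mp (H.blue_disjoint g hg h hh hne) hx hx'
    admissible := by
      simpa only [mem_formalSum] using H.admissible }

end BergmanGraph

namespace BergmanPresentation

variable {X : Type u} {I : Type v}

/-- A base generator: a generator that lies in no `X_i` with `i` blue. -/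
def IsBase (P : BergmanPresentation X I) (x : X) : Prop :=
  ∀ i ∈ P.blue, x ∉ P.b i

/-- A Bergman presentation is basic if all its generators are base generators. -/
def IsBasic (P : BergmanPresentation X I) : Prop :=
  ∀ x, P.IsBase x

open Classical in
/-- `P.Slot x` is the index set of the rows (and columns) of the square matrix `ε_x`: a single
index if `x` is a base generator; and if `x` is a summand of the right-hand side of a blue
relation `a i = b i`, the index set of the block diagonal matrix `ε_{a i}`, that is, the set of the
triples `(y, k, q)` where `k` numbers the occurrences of `y` in `a i` and `q` is an index of
`ε_y`. -/
inductive Slot (P : BergmanPresentation X I) : X → Type (max u v)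
  | base (x : X) (hx : P.IsBase x) : Slot P x
  | blue (x : X) (i : I) (hi : i ∈ P.blue) (hx : x ∈ P.b i) (y : X)
      (k : Fin ((P.a i).count y)) (q : Slot P y) : Slot P x

open Classical in
/-- The occurrences of generators in an element `c` of the free abelian monoid. -/
abbrev Occ (c : Multiset X) : Type u := Σ y : X, Fin (c.count y)

/-- The index set of the square matrix `ε_c`, for `c` in the free abelian monoid. -/
abbrev Idx (P : BergmanPresentation X I) (c : Multiset X) : Type (max u v) :=
  Σ o : Occ c, P.Slot o.1

/-- The identification of the index set of `ε_{a i}` with that of `ε_x`, for `i` blue and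
`x ∈ X_i`. -/
def blueSlot (P : BergmanPresentation X I) {i : I} (hi : i ∈ P.blue) {x : X} (hx : x ∈ P.b i)
    (q : P.Idx (P.a i)) : P.Slot x :=
  Slot.blue x i hi hx q.1.1 q.1.2 q.2

theorem finite_slot_of_base (P : BergmanPresentation X I) {x : X} (hx : P.IsBase x) :
    Finite (P.Slot x) := by
  suffices h : Subsingleton (P.Slot x) from @Finite.of_subsingleton _ h
  refine ⟨fun p q => ?_⟩
  cases p with
  | base _ _ =>
    cases q with
    | base _ _ => rfl
    | blue _ i hi h _ _ _ => exact absurd h (hx i hi)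
  | blue _ i hi h _ _ _ => exact absurd h (hx i hi)

theorem finite_slot_of_blue (P : BergmanPresentation X I) {i : I} (hi : i ∈ P.blue) {x : X}
    (hx : x ∈ P.b i) (h : ∀ y ∈ P.a i, Finite (P.Slot y)) : Finite (P.Slot x) := by
  classical
  have := P.finite_generators
  have : ∀ o : Occ (P.a i), Finite (P.Slot o.1) := fun o =>
    h o.1 (Multiset.count_pos.mp (lt_of_le_of_lt (Nat.zero_le _) o.2.2))
  refine Finite.of_surjective (P.blueSlot hi hx) ?_
  intro p
  cases p with
  | base _ hb => exact absurd hx (hb i hi)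
  | blue _ j hj hxj y k q =>
    have hij : j = i := by
      by_contra hne
      exact P.blue_disjoint j hj i hi hne x hxj hx
    subst hij
    exact ⟨⟨⟨y, k⟩, q⟩, rfl⟩

instance finite_slot (P : BergmanPresentation X I) (x : X) : Finite (P.Slot x) := by
  obtain ⟨m, e, he⟩ := P.admissible
  have key : ∀ n : ℕ, ∀ k : Fin m, k.1 = n → ∀ y ∈ P.b (e k), Finite (P.Slot y) := by
    intro n
    induction n using Nat.strong_induction_on with
    | _ n ih =>
      intro k hk y hy
      refine P.finite_slot_of_blue (e k).2 hy ?_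
      intro z hz
      rcases he k z hz with hz | ⟨p, hp, hz⟩
      · exact P.finite_slot_of_base hz
      · exact ih p.1 (hk ▸ hp) p rfl z hz
  by_cases hx : P.IsBase x
  · exact P.finite_slot_of_base hx
  · simp only [IsBase, not_forall, not_not] at hx
    obtain ⟨i, hi, hxi⟩ := hx
    refine key _ (e.symm ⟨i, hi⟩) rfl x ?_
    simpa using hxi

instance fintypeGenerators (P : BergmanPresentation X I) : Fintype {x : X // P.IsBase x} :=
  haveI := P.finite_generators
  Fintype.ofFinite _

instance fintypeSummands (c : Multiset X) : Fintype {x : X // x ∈ c} := by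
  classical
  exact Fintype.ofFinset c.toFinset (fun _ => Multiset.mem_toFinset)

instance fintypeIdx (P : BergmanPresentation X I) (c : Multiset X) : Fintype (P.Idx c) :=
  haveI := P.finite_generators
  Fintype.ofFinite _

/-- The symbols that generate the Bergman algebra: the entries of the matrices `ε_x` for all
generators `x`, and of the matrices `σ_i` and `σ'_i` for all red `i`. -/
inductive Sym (P : BergmanPresentation X I) : Type (max u v)
  | eps (x : X) (p q : P.Slot x) : Sym P
  | sigma (i : I) (hi : i ∉ P.blue) (p : P.Idx (P.a i)) (q : P.Idx (P.b i)) : Sym P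
  | sigma' (i : I) (hi : i ∉ P.blue) (q : P.Idx (P.b i)) (p : P.Idx (P.a i)) : Sym P

section Matrices

variable (K : Type w) [Field K] (P : BergmanPresentation X I)

/-- The matrix `ε_x` of symbols. -/
def epsGen (x : X) : Matrix (P.Slot x) (P.Slot x) (FreeAlgebra K P.Sym) :=
  Matrix.of fun p q => FreeAlgebra.ι K (Sym.eps x p q)

open Classical in
/-- The matrix `ε_c = ε_{x_1} ⊕ ⋯ ⊕ ε_{x_n}` for `c = x_1 + ⋯ + x_n`. -/
def epsSum (c : Multiset X) : Matrix (P.Idx c) (P.Idx c) (FreeAlgebra K P.Sym) :=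
  Matrix.blockDiagonal' fun o : Occ c => epsGen K P o.1

/-- For a base generator `x`, the unique entry of the one by one matrix `ε_x`. -/
def epsBase (x : X) (hx : P.IsBase x) : FreeAlgebra K P.Sym :=
  epsGen K P x (Slot.base x hx) (Slot.base x hx)

/-- For `i` blue and `x ∈ X_i`, the matrix `ε_x` as a matrix of the size of `ε_{a i}`. -/
def epsBlue {i : I} (hi : i ∈ P.blue) {x : X} (hx : x ∈ P.b i) :
    Matrix (P.Idx (P.a i)) (P.Idx (P.a i)) (FreeAlgebra K P.Sym) :=
  (epsGen K P x).submatrix (P.blueSlot hi hx) (P.blueSlot hi hx)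

/-- The matrix `σ_i` of symbols. -/
def sigmaMat (i : I) (hi : i ∉ P.blue) :
    Matrix (P.Idx (P.a i)) (P.Idx (P.b i)) (FreeAlgebra K P.Sym) :=
  Matrix.of fun p q => FreeAlgebra.ι K (Sym.sigma i hi p q)

/-- The matrix `σ'_i` of symbols. -/
def sigmaMat' (i : I) (hi : i ∉ P.blue) :
    Matrix (P.Idx (P.b i)) (P.Idx (P.a i)) (FreeAlgebra K P.Sym) :=
  Matrix.of fun q p => FreeAlgebra.ι K (Sym.sigma' i hi q p)

/-- The defining relations of the Bergman algebra.
* `base_*`: the `ε_x`, `x` a base generator, are orthogonal idempotents with sum `1`, so that they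
  generate `K^{X_base}`.
* `blue_*`: for `i` blue, the `ε_x`, `x ∈ X_i`, are orthogonal idempotent matrices in the corner
  of `ε_{a i}` with sum `ε_{a i}`; this adjoins a universal decomposition
  `[P_{a i}] = ∑ x ∈ X_i, [P_x]`.
* `red_*`: for `i` red, `σ_i` and `σ'_i` are mutually inverse isomorphisms between the projective
  modules given by `ε_{a i}` and `ε_{b i}`; this adjoins a universal isomorphism
  `[P_{a i}] = [P_{b i}]`. -/
inductive Rel : FreeAlgebra K P.Sym → FreeAlgebra K P.Sym → Prop
  | base_idem (x : X) (hx : P.IsBase x) :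
      Rel (epsBase K P x hx * epsBase K P x hx) (epsBase K P x hx)
  | base_orth (x y : X) (hx : P.IsBase x) (hy : P.IsBase y) (hxy : x ≠ y) :
      Rel (epsBase K P x hx * epsBase K P y hy) 0
  | base_sum : Rel (∑ x : {x : X // P.IsBase x}, epsBase K P x.1 x.2) 1
  | blue_corner (i : I) (hi : i ∈ P.blue) (x : X) (hx : x ∈ P.b i) (p q : P.Idx (P.a i)) :
      Rel ((epsSum K P (P.a i) * epsBlue K P hi hx * epsSum K P (P.a i)) p q)
        (epsBlue K P hi hx p q)
  | blue_idem (i : I) (hi : i ∈ P.blue) (x : X) (hx : x ∈ P.b i) (p q : P.Idx (P.a i)) :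
      Rel ((epsBlue K P hi hx * epsBlue K P hi hx) p q) (epsBlue K P hi hx p q)
  | blue_orth (i : I) (hi : i ∈ P.blue) (x y : X) (hx : x ∈ P.b i) (hy : y ∈ P.b i)
      (hxy : x ≠ y) (p q : P.Idx (P.a i)) :
      Rel ((epsBlue K P hi hx * epsBlue K P hi hy) p q) 0
  | blue_sum (i : I) (hi : i ∈ P.blue) (p q : P.Idx (P.a i)) :
      Rel ((∑ x : {x : X // x ∈ P.b i}, epsBlue K P hi x.2) p q) (epsSum K P (P.a i) p q)
  | red_sigma (i : I) (hi : i ∉ P.blue) (p : P.Idx (P.a i)) (q : P.Idx (P.b i)) :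
      Rel ((epsSum K P (P.a i) * sigmaMat K P i hi * epsSum K P (P.b i)) p q)
        (sigmaMat K P i hi p q)
  | red_sigma' (i : I) (hi : i ∉ P.blue) (q : P.Idx (P.b i)) (p : P.Idx (P.a i)) :
      Rel ((epsSum K P (P.b i) * sigmaMat' K P i hi * epsSum K P (P.a i)) q p)
        (sigmaMat' K P i hi q p)
  | red_left (i : I) (hi : i ∉ P.blue) (p q : P.Idx (P.a i)) :
      Rel ((sigmaMat K P i hi * sigmaMat' K P i hi) p q) (epsSum K P (P.a i) p q)
  | red_right (i : I) (hi : i ∉ P.blue) (p q : P.Idx (P.b i)) :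
      Rel ((sigmaMat' K P i hi * sigmaMat K P i hi) p q) (epsSum K P (P.b i) p q)

/-- The Bergman algebra `B(X, R)` over the field `K`. -/
abbrev BergmanAlgebra : Type (max u v w) := RingQuot (Rel K P)

end Matrices

open Classical in
/-- `splitSum x₁ new gen φ c` is obtained from `c` by keeping (through `old`) all summands other
than `x₁` and replacing the `k`-th occurrence of `x₁` by the generator `gen (φ k)`. -/
def splitSum {X' : Type u} {n : ℕ} (x₁ : X) (old : X → X') (gen : Fin n → X')
    (c : Multiset X) (φ : Fin (c.count x₁) → Fin n) : Multiset X' :=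
  (c.filter (fun x => x ≠ x₁)).map old +
    ∑ k : Fin (c.count x₁), ({gen (φ k)} : Multiset X')

open Classical in
/-- `P'` can be obtained from the basic presentation `P` by insplitting. With `t = s + 1 ≥ 1`, a
partition of the set `S` of the occurrences of `x₁` on right-hand sides into nonempty sets
`S_1, …, S_t` is a surjection `φ` from `S` onto `Fin (s + 1)`; in particular `S` is nonempty.
Through `eX`, the generators of `P'` are those of `P` and `s` new ones; through `eI`, the relations
of `P'` are indexed by the indices of `P` and `s` new ones. The copies `x_1, …, x_t` are `gen 0`
(the generator `x₁` itself), `gen 1`, …, `gen s`, and the relation `x_p = b'_i` has the index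
`rel (p - 1)`, where `rel 0` is the old index `i`. -/
def IsInsplitting {X' : Type u} {I' : Type v} (P : BergmanPresentation X I)
    (P' : BergmanPresentation X' I') : Prop :=
  P.IsBasic ∧ P'.IsBasic ∧
  ∃ (x₁ : X) (i : I) (s : ℕ) (φ : (Σ j : I, Fin ((P.b j).count x₁)) → Fin (s + 1))
    (eX : X ⊕ Fin s ≃ X') (eI : I ⊕ Fin s ≃ I'),
    P.a i = {x₁} ∧ (∀ j, j ≠ i → x₁ ∉ P.a j) ∧ Function.Surjective φ ∧
    let old : X → X' := fun x => eX (Sum.inl x)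
    let gen : Fin (s + 1) → X' := Fin.cons (old x₁) fun q => eX (Sum.inr q)
    let rel : Fin (s + 1) → I' := Fin.cons (eI (Sum.inl i)) fun q => eI (Sum.inr q)
    let b' : I → Multiset X' := fun j => splitSum x₁ old gen (P.b j) fun k => φ ⟨j, k⟩
    (∀ j, j ≠ i → P'.a (eI (Sum.inl j)) = (P.a j).map old ∧ P'.b (eI (Sum.inl j)) = b' j) ∧
    ∀ p, P'.a (rel p) = {gen p} ∧ P'.b (rel p) = b' i

end BergmanPresentation

namespace BergmanGraph

variable {V : Type u} {E : Type v}

/-- The Bergman algebra `B(H)` of a Bergman graph over the field `K`. -/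
abbrev BergmanAlgebra (K : Type w) [Field K] (H : BergmanGraph V E) : Type (max u v w) :=
  BergmanPresentation.BergmanAlgebra K H.toPresentation

open Classical in
/-- `H'` can be obtained from the basic Bergman graph `H` by insplitting. With `t = n + 1 ≥ 1`, a
partition of the set `S` of the pairs `(g, k)`, `1 ≤ k ≤ r(g)(v₁)`, into nonempty sets
`S_1, …, S_t` is a surjection `φ` from `S` onto `Fin (n + 1)`. The vertices (hyperedges) of `H'`
are, through `eV` (`eE`), those of `H` and `n` new ones; `vtx 0` is `v₁` and `edge 0` is `h₁`. -/
def IsInsplitting {V' : Type u} {E' : Type v} (H : BergmanGraph V E)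
    (H' : BergmanGraph V' E') : Prop :=
  H.IsBasic ∧ H'.IsBasic ∧
  ∃ (v₁ : V) (h₁ : E) (n : ℕ) (φ : (Σ g : E, Fin (H.r g v₁)) → Fin (n + 1))
    (eV : V ⊕ Fin n ≃ V') (eE : E ⊕ Fin n ≃ E'),
    H.s h₁ = Pi.single v₁ 1 ∧ (∀ g, g ≠ h₁ → H.s g v₁ = 0) ∧ Function.Surjective φ ∧
    let old : V → V' := fun u => eV (Sum.inl u)
    let vtx : Fin (n + 1) → V' := Fin.cons (old v₁) fun q => eV (Sum.inr q)
    let edge : Fin (n + 1) → E' := Fin.cons (eE (Sum.inl h₁)) fun q => eE (Sum.inr q)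
    (∀ g, g ≠ h₁ →
      (∀ u, H'.s (eE (Sum.inl g)) (old u) = H.s g u) ∧
      (∀ q, H'.s (eE (Sum.inl g)) (vtx q) = 0) ∧
      (∀ u, u ≠ v₁ → H'.r (eE (Sum.inl g)) (old u) = H.r g u) ∧
      ∀ q, H'.r (eE (Sum.inl g)) (vtx q) = Nat.card {k : Fin (H.r g v₁) // φ ⟨g, k⟩ = q}) ∧
    ∀ p,
      H'.s (edge p) = Pi.single (vtx p) 1 ∧
      (∀ u, u ≠ v₁ → H'.r (edge p) (old u) = H.r h₁ u) ∧
      ∀ q, H'.r (edge p) (vtx q) = Nat.card {k : Fin (H.r h₁ v₁) // φ ⟨h₁, k⟩ = q}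

end BergmanGraph

end

/-!
By its universal property, the algebra `B(X, R)` of a basic presentation has as modules the families
of vector spaces `M_x`, `x ∈ X`, together with isomorphisms between the direct sums of the `M_x`
over the summands of `a i` and of `b i`, for all `i`. Insplitting replaces `x₁`, which occurs as a
left-hand side, by copies that are all equated with the same right-hand side. So the spaces at the
copies are isomorphic to each other, through this common right-hand side, and every representation
of the new presentation is isomorphic to one that has the same space at all copies, that is, to a
representation of the old presentation.
-/

section Realizations

open Matrix

universe u₁ u₂ u₃ u₃'

theorem exists_equiv_comp_eq_of_map_univ_eq {F G Z : Type*} [Fintype F] [Fintype G]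
    {f : F → Z} {g : G → Z} (h : Finset.univ.val.map f = Finset.univ.val.map g) :
    ∃ e : F ≃ G, g ∘ e = f := by
  classical
  have card_fiber (z : Z) : Fintype.card {x // f x = z} = Fintype.card {y // g y = z} := by
    simpa only [Multiset.count_map, Fintype.card_subtype, Finset.card_def, Finset.filter_val,
      eq_comm] using congrArg (Multiset.count z) h
  exact ⟨Equiv.ofFiberEquiv fun z => Fintype.equivOfCardEq (card_fiber z),
    funext fun x => Equiv.ofFiberEquiv_map _ x⟩

/-- A family of relations `∑ a, α j a = ∑ b, β j b` in the free abelian monoid on `Y`, both sides of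
which are written as finite sums of generators, so that their summands can index matrices. -/
structure RelationFamily (Y : Type u₁) (J : Type u₂) where
  A : J → Type u₃
  B : J → Type u₃
  [fintypeA : ∀ j, Fintype (A j)]
  [fintypeB : ∀ j, Fintype (B j)]
  α : ∀ j, A j → Y
  β : ∀ j, B j → Y

attribute [instance] RelationFamily.fintypeA RelationFamily.fintypeB

namespace RelationFamily

variable {Y Y' J J' : Type*} (D : RelationFamily.{_, _, u₃} Y J)
  (D' : RelationFamily.{_, _, u₃'} Y' J') (R : Type*) [Ring R]

open Classical in
/-- A realization of a family of relations in a ring: a decomposition `1 = ∑ y, e y` into orthogonal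
idempotents together with mutually inverse matrices `s j` and `t j` that identify the projective
modules given by the two sides of the relation `j`. -/
@[ext]
structure Realization [Fintype Y] where
  e : Y → R
  s : ∀ j, Matrix (D.A j) (D.B j) R
  t : ∀ j, Matrix (D.B j) (D.A j) R
  complete : CompleteOrthogonalIdempotents e
  e_mul_s : ∀ j a b, e (D.α j a) * s j a b = s j a b
  s_mul_e : ∀ j a b, s j a b * e (D.β j b) = s j a b
  e_mul_t : ∀ j b a, e (D.β j b) * t j b a = t j b a
  t_mul_e : ∀ j b a, t j b a * e (D.α j a) = t j b a
  s_mul_t : ∀ j, s j * t j = diagonal (e ∘ D.α j)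
  t_mul_s : ∀ j, t j * s j = diagonal (e ∘ D.β j)

/-- An identification of two families of relations up to renaming the generators, the relations and
the summands of both sides of the relations. -/
structure Iso where
  gen : Y ≃ Y'
  rel : J ≃ J'
  left : ∀ j, D.A j ≃ D'.A (rel j)
  right : ∀ j, D.B j ≃ D'.B (rel j)
  α_left : ∀ j a, D'.α (rel j) (left j a) = gen (D.α j a)
  β_right : ∀ j b, D'.β (rel j) (right j b) = gen (D.β j b)

variable {D D' R}

theorem Iso.nonempty_of_map_eq (gen : Y ≃ Y') (rel : J ≃ J')
    (left : ∀ j, (Finset.univ.val.map (D.α j)).map gen = Finset.univ.val.map (D'.α (rel j)))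
    (right : ∀ j, (Finset.univ.val.map (D.β j)).map gen = Finset.univ.val.map (D'.β (rel j))) :
    Nonempty (D.Iso D') := by
  simp only [Multiset.map_map] at left right
  choose l hl using fun j => exists_equiv_comp_eq_of_map_univ_eq (left j)
  choose r hr using fun j => exists_equiv_comp_eq_of_map_univ_eq (right j)
  exact ⟨gen, rel, l, r, fun j => congrFun (hl j), fun j => congrFun (hr j)⟩

namespace Realization

variable [Fintype Y] [Fintype Y'] {S : Type*} [Ring S]

open Classical in
/-- The image of a realization under a ring homomorphism. -/
def map (φ : R →+* S) (ρ : D.Realization R) : D.Realization S where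
  e y := φ (ρ.e y)
  s j := (ρ.s j).map φ
  t j := (ρ.t j).map φ
  complete := ρ.complete.map φ
  e_mul_s j a b := by simp only [map_apply, ← map_mul, ρ.e_mul_s]
  s_mul_e j a b := by simp only [map_apply, ← map_mul, ρ.s_mul_e]
  e_mul_t j b a := by simp only [map_apply, ← map_mul, ρ.e_mul_t]
  t_mul_e j b a := by simp only [map_apply, ← map_mul, ρ.t_mul_e]
  s_mul_t j := by rw [← Matrix.map_mul, ρ.s_mul_t, diagonal_map (map_zero φ)]; rfl
  t_mul_s j := by rw [← Matrix.map_mul, ρ.t_mul_s, diagonal_map (map_zero φ)]; rfl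

/-- The set of all entries of the matrices of a realization. -/
def entries (ρ : D.Realization R) : Set R :=
  {x | (∃ y, ρ.e y = x) ∨ (∃ j a b, ρ.s j a b = x) ∨ ∃ j b a, ρ.t j b a = x}

/-- The realization `ρ` is the universal one in a `K`-algebra: every other one is the image of `ρ`
under a `K`-algebra homomorphism. The uniqueness of the homomorphism is encoded in the condition
that the entries of `ρ` generate the algebra. The targets live in one universe. -/
structure IsUniversal (K : Type*) [CommRing K] [Algebra K R] (ρ : D.Realization R) : Prop where
  exists_map_eq : ∀ (S : Type w) [Ring S] [Algebra K S] (σ : D.Realization S),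
    ∃ φ : R →ₐ[K] S, ρ.map (φ : R →+* S) = σ
  adjoin_entries : Algebra.adjoin K ρ.entries = ⊤

open Classical in
/-- The realization of `D` that a realization of `D'` gives through an identification of `D` with
`D'`. -/
def comap (f : D.Iso D') (ρ : D'.Realization R) : D.Realization R where
  e := ρ.e ∘ f.gen
  s j := (ρ.s (f.rel j)).submatrix (f.left j) (f.right j)
  t j := (ρ.t (f.rel j)).submatrix (f.right j) (f.left j)
  complete := (CompleteOrthogonalIdempotents.equiv f.gen).2 ρ.complete
  e_mul_s j a b := by simp [← f.α_left, ρ.e_mul_s]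
  s_mul_e j a b := by simp [← f.β_right, ρ.s_mul_e]
  e_mul_t j b a := by simp [← f.β_right, ρ.e_mul_t]
  t_mul_e j b a := by simp [← f.α_left, ρ.t_mul_e]
  s_mul_t j := by
    rw [submatrix_mul_equiv, ρ.s_mul_t, submatrix_diagonal_equiv]
    congr 1; ext a; simp [f.α_left]
  t_mul_s j := by
    rw [submatrix_mul_equiv, ρ.t_mul_s, submatrix_diagonal_equiv]
    congr 1; ext a; simp [f.β_right]

open Classical in
theorem comap_surjective (f : D.Iso D') :
    Function.Surjective (comap f : D'.Realization R → D.Realization R) := by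
  intro σ
  let s' := f.rel.piCongrLeft (fun j' => Matrix (D'.A j') (D'.B j') R) fun j =>
    (σ.s j).submatrix (f.left j).symm (f.right j).symm
  let t' := f.rel.piCongrLeft (fun j' => Matrix (D'.B j') (D'.A j') R) fun j =>
    (σ.t j).submatrix (f.right j).symm (f.left j).symm
  have s'_rel j : s' (f.rel j) = (σ.s j).submatrix (f.left j).symm (f.right j).symm :=
    f.rel.piCongrLeft_apply_apply _ _ j
  have t'_rel j : t' (f.rel j) = (σ.t j).submatrix (f.right j).symm (f.left j).symm :=
    f.rel.piCongrLeft_apply_apply _ _ j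
  have e_α j a : (σ.e ∘ f.gen.symm) (D'.α (f.rel j) a) = σ.e (D.α j ((f.left j).symm a)) := by
    simpa [Equiv.symm_apply_eq] using congrArg σ.e (congrArg f.gen.symm
      (f.α_left j ((f.left j).symm a)))
  have e_β j b : (σ.e ∘ f.gen.symm) (D'.β (f.rel j) b) = σ.e (D.β j ((f.right j).symm b)) := by
    simpa [Equiv.symm_apply_eq] using congrArg σ.e (congrArg f.gen.symm
      (f.β_right j ((f.right j).symm b)))
  refine ⟨{
    e := σ.e ∘ f.gen.symm
    s := s'
    t := t'
    complete := (CompleteOrthogonalIdempotents.equiv f.gen.symm).2 σ.complete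
    e_mul_s := f.rel.forall_congr_right.1 fun j a b => by
      rw [e_α, s'_rel, submatrix_apply, σ.e_mul_s]
    s_mul_e := f.rel.forall_congr_right.1 fun j a b => by
      rw [e_β, s'_rel, submatrix_apply, σ.s_mul_e]
    e_mul_t := f.rel.forall_congr_right.1 fun j b a => by
      rw [e_β, t'_rel, submatrix_apply, σ.e_mul_t]
    t_mul_e := f.rel.forall_congr_right.1 fun j b a => by
      rw [e_α, t'_rel, submatrix_apply, σ.t_mul_e]
    s_mul_t := f.rel.forall_congr_right.1 fun j => by
      rw [s'_rel, t'_rel, submatrix_mul_equiv, σ.s_mul_t, submatrix_diagonal_equiv]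
      exact congrArg diagonal (funext fun a => (e_α j a).symm)
    t_mul_s := f.rel.forall_congr_right.1 fun j => by
      rw [s'_rel, t'_rel, submatrix_mul_equiv, σ.t_mul_s, submatrix_diagonal_equiv]
      exact congrArg diagonal (funext fun b => (e_β j b).symm) }, ?_⟩
  ext <;> simp [comap, s'_rel, t'_rel]

theorem entries_subset_entries_comap (f : D.Iso D') (ρ : D'.Realization R) :
    ρ.entries ⊆ (ρ.comap f).entries := by
  rintro _ (⟨y, rfl⟩ | ⟨j, a, b, rfl⟩ | ⟨j, b, a, rfl⟩)
  · obtain ⟨y, rfl⟩ := f.gen.surjective y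
    exact .inl ⟨y, rfl⟩
  · obtain ⟨j, rfl⟩ := f.rel.surjective j
    obtain ⟨a, rfl⟩ := (f.left j).surjective a
    obtain ⟨b, rfl⟩ := (f.right j).surjective b
    exact .inr (.inl ⟨j, a, b, rfl⟩)
  · obtain ⟨j, rfl⟩ := f.rel.surjective j
    obtain ⟨a, rfl⟩ := (f.left j).surjective a
    obtain ⟨b, rfl⟩ := (f.right j).surjective b
    exact .inr (.inr ⟨j, b, a, rfl⟩)

theorem IsUniversal.comap {K : Type*} [CommRing K] [Algebra K R] {ρ : D'.Realization R}
    (hρ : IsUniversal.{w} K ρ) (f : D.Iso D') : IsUniversal.{w} K (ρ.comap f) where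
  exists_map_eq S _ _ σ := by
    obtain ⟨σ', rfl⟩ := comap_surjective f σ
    obtain ⟨φ, rfl⟩ := hρ.exists_map_eq S σ'
    exact ⟨φ, rfl⟩
  adjoin_entries := top_unique <|
    hρ.adjoin_entries.ge.trans (Algebra.adjoin_mono (entries_subset_entries_comap f ρ))

end Realization

end RelationFamily

end Realizations

section Representations

open CategoryTheory Matrix

universe u₁ u₂ u₃ z

namespace RelationFamily

variable {Y : Type u₁} {J : Type u₂}

/-- A representation of a family of relations: a `K`-module for every generator and an isomorphism
between the direct sums given by the two sides of every relation. -/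
structure Representation (D : RelationFamily.{u₁, u₂, u₃} Y J) (K : Type w) [CommRing K] where
  obj : Y → Type z
  [addCommGroup : ∀ y, AddCommGroup (obj y)]
  [module : ∀ y, Module K (obj y)]
  iso : ∀ j, (∀ a, obj (D.α j a)) ≃ₗ[K] (∀ b, obj (D.β j b))

attribute [instance] Representation.addCommGroup Representation.module

namespace Representation

variable {D : RelationFamily.{u₁, u₂, u₃} Y J} {K : Type w} [CommRing K]

/-- The `K`-module of morphisms of representations: the families of linear maps that commute with
the isomorphisms `iso j`. -/
def homs (M N : D.Representation K) : Submodule K (∀ y, M.obj y →ₗ[K] N.obj y) where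
  carrier := {f | ∀ j m, N.iso j (fun a => f (D.α j a) (m a)) =
    fun b => f (D.β j b) (M.iso j m b)}
  add_mem' hf hg j m := (map_add (N.iso j) _ _).trans (congrArg₂ (· + ·) (hf j m) (hg j m))
  zero_mem' j _ := map_zero (N.iso j)
  smul_mem' k _ hf j m := (map_smul (N.iso j) k _).trans (congrArg (k • ·) (hf j m))

instance : Category (D.Representation K) where
  Hom M N := homs M N
  id M := ⟨fun _ => LinearMap.id, fun _ _ => rfl⟩
  comp f g := ⟨fun y => g.1 y ∘ₗ f.1 y, fun j m =>
    (g.2 j _).trans (funext fun b => congrArg (g.1 (D.β j b)) (congrFun (f.2 j m) b))⟩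

instance : Preadditive (D.Representation K) where
  homGroup M N := inferInstanceAs (AddCommGroup (homs M N))
  add_comp _ _ _ _ _ g := Subtype.ext <| funext fun y => LinearMap.comp_add _ _ (g.1 y)
  comp_add _ _ _ _ _ _ := rfl

instance : Linear K (D.Representation K) where
  homModule M N := inferInstanceAs (Module K (homs M N))
  smul_comp _ _ _ k f g := Subtype.ext <| funext fun y => LinearMap.comp_smul (g.1 y) k (f.1 y)
  comp_smul _ _ _ _ _ _ := rfl

variable {M N : D.Representation K}

theorem hom_ext {f g : M ⟶ N} (h : ∀ y, f.1 y = g.1 y) : f = g := Subtype.ext (funext h)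

/-- An isomorphism of representations given by linear equivalences. -/
def isoMk (f : ∀ y, M.obj y ≃ₗ[K] N.obj y)
    (hf : ∀ j m, N.iso j (fun a => f (D.α j a) (m a)) = fun b => f (D.β j b) (M.iso j m b)) :
    M ≅ N where
  hom := ⟨fun y => f y, hf⟩
  inv := ⟨fun y => (f y).symm, fun j n => by
    have h := hf j fun a => (f _).symm (n a)
    simp only [LinearEquiv.apply_symm_apply] at h
    exact funext fun b => (f _).eq_symm_apply.2 (congrFun h b).symm⟩
  hom_inv_id := hom_ext fun y => (f y).symm_comp
  inv_hom_id := hom_ext fun y => (f y).comp_symm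

section BlockMatrix

variable (M)

open Classical in
/-- The matrix of a linear map between sums of modules `M.obj y`, with entries in the endomorphism
ring of the direct sum of all of them. -/
noncomputable def blockMatrix {A B : Type*} {α : A → Y} {β : B → Y}
    (φ : (∀ a, M.obj (α a)) →ₗ[K] ∀ b, M.obj (β b)) : Matrix B A (Module.End K (∀ y, M.obj y)) :=
  of fun b a => LinearMap.single K M.obj (β b) ∘ₗ LinearMap.proj b ∘ₗ φ ∘ₗ
    LinearMap.single K (fun a => M.obj (α a)) a ∘ₗ LinearMap.proj (α a)

open Classical in
theorem blockMatrix_apply {A B : Type*} {α : A → Y} {β : B → Y}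
    (φ : (∀ a, M.obj (α a)) →ₗ[K] ∀ b, M.obj (β b)) (b : B) (a : A) (m : ∀ y, M.obj y) :
    M.blockMatrix φ b a m =
      LinearMap.single K M.obj (β b) (φ (Pi.single a (m (α a))) b) := rfl

open Classical in
/-- The projection of the direct sum of all `M.obj y` onto one summand. -/
noncomputable def blockProj (y : Y) : Module.End K (∀ y, M.obj y) :=
  LinearMap.single K M.obj y ∘ₗ LinearMap.proj y

open Classical in
theorem blockProj_apply (y : Y) (m : ∀ y, M.obj y) : M.blockProj y m = Pi.single y (m y) := rfl

theorem completeOrthogonalIdempotents_blockProj [Fintype Y] :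
    CompleteOrthogonalIdempotents M.blockProj where
  idem y := LinearMap.ext fun m => by simp [blockProj_apply]
  ortho y y' h := LinearMap.ext fun m => by simp [blockProj_apply, h]
  complete := LinearMap.ext fun m => by
    classical simp [blockProj_apply, Finset.univ_sum_single]

section

variable {A B C : Type*} {α : A → Y} {β : B → Y} {γ : C → Y}
  (φ : (∀ a, M.obj (α a)) →ₗ[K] ∀ b, M.obj (β b))

theorem blockProj_mul_blockMatrix (b : B) (a : A) :
    M.blockProj (β b) * M.blockMatrix φ b a = M.blockMatrix φ b a :=
  LinearMap.ext fun m => by simp [blockProj_apply, blockMatrix_apply]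

theorem blockMatrix_mul_blockProj (b : B) (a : A) :
    M.blockMatrix φ b a * M.blockProj (α a) = M.blockMatrix φ b a :=
  LinearMap.ext fun m => by simp [blockProj_apply, blockMatrix_apply]

theorem blockMatrix_mul [Fintype B] (ψ : (∀ b, M.obj (β b)) →ₗ[K] ∀ c, M.obj (γ c)) :
    M.blockMatrix ψ * M.blockMatrix φ = M.blockMatrix (ψ ∘ₗ φ) := by
  classical
  refine Matrix.ext fun c a => LinearMap.ext fun m => ?_
  have sum_ψ (v : ∀ b, M.obj (β b)) : ψ v c = ∑ b, ψ (Pi.single b (v b)) c := by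
    rw [← Finset.sum_apply, ← map_sum, Finset.univ_sum_single]
  simp only [mul_apply, LinearMap.sum_apply, Module.End.mul_apply, blockMatrix_apply,
    LinearMap.single_apply, Pi.single_eq_same, LinearMap.comp_apply]
  rw [sum_ψ]
  exact (map_sum (LinearMap.single K M.obj (γ c)) _ _).symm

open Classical in
theorem blockMatrix_id :
    M.blockMatrix (LinearMap.id : (∀ a, M.obj (α a)) →ₗ[K] _) = diagonal (M.blockProj ∘ α) := by
  refine Matrix.ext fun a a' => LinearMap.ext fun m => ?_
  obtain rfl | h := eq_or_ne a a' <;> simp [blockMatrix_apply, blockProj_apply, *]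

end

/-- The realization of a family of relations by endomorphisms of the direct sum of the modules of a
representation. -/
noncomputable def realization [Fintype Y] : D.Realization (Module.End K (∀ y, M.obj y)) where
  e := M.blockProj
  s j := M.blockMatrix (M.iso j).symm.toLinearMap
  t j := M.blockMatrix (M.iso j).toLinearMap
  complete := M.completeOrthogonalIdempotents_blockProj
  e_mul_s _ := M.blockProj_mul_blockMatrix _
  s_mul_e _ := M.blockMatrix_mul_blockProj _
  e_mul_t _ := M.blockProj_mul_blockMatrix _
  t_mul_e _ := M.blockMatrix_mul_blockProj _
  s_mul_t j := by rw [blockMatrix_mul, LinearEquiv.symm_comp, blockMatrix_id]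
  t_mul_s j := by rw [blockMatrix_mul, LinearEquiv.comp_symm, blockMatrix_id]

end BlockMatrix

end Representation

theorem map_smul_of_adjoin_eq_top {K A M N : Type*} [CommRing K] [Ring A] [Algebra K A]
    [AddCommGroup M] [Module K M] [Module A M] [IsScalarTower K A M]
    [AddCommGroup N] [Module K N] [Module A N] [IsScalarTower K A N]
    {s : Set A} (hs : Algebra.adjoin K s = ⊤) (f : M →ₗ[K] N)
    (hf : ∀ x ∈ s, ∀ m, f (x • m) = x • f m) (x : A) (m : M) : f (x • m) = x • f m := by
  have hx : x ∈ Algebra.adjoin K s := hs ▸ Algebra.mem_top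
  induction hx using Algebra.adjoin_induction generalizing m with
  | mem x hx => exact hf x hx m
  | algebraMap k => simp only [algebraMap_smul, map_smul]
  | add x y _ _ hx hy => simp only [add_smul, map_add, hx, hy]
  | mul x y _ _ hx hy => simp only [mul_smul, hx, hy]

namespace Realization

variable [Fintype Y] {D : RelationFamily.{u₁, u₂, u₃} Y J} {K : Type w} {R : Type*} [Ring R]
  (ρ : D.Realization R)

section Components

variable [CommRing K] [Algebra K R] (M : Type*) [AddCommGroup M] [Module R M] [Module K M]
  [IsScalarTower K R M]

/-- The summand `e y • M` of an `R`-module `M`, for the idempotent `e y` of a realization. -/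
def component (y : Y) : Submodule K M :=
  LinearMap.eqLocus (Algebra.lsmul K K M (ρ.e y)) LinearMap.id

variable {M}

theorem mem_component {y : Y} {m : M} : m ∈ ρ.component (K := K) M y ↔ ρ.e y • m = m := Iff.rfl

theorem smul_mem_component {r : R} {y : Y} (h : ρ.e y * r = r) (m : M) :
    r • m ∈ ρ.component (K := K) M y := by
  rw [mem_component, smul_smul, h]

variable (M) in
/-- The linear map between sums of components that a matrix defines. -/
def matrixMap {A B : Type*} [Fintype A] {α : A → Y} {β : B → Y} (x : Matrix B A R)
    (hx : ∀ b a, ρ.e (β b) * x b a = x b a) :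
    (∀ a, ρ.component (K := K) M (α a)) →ₗ[K] ∀ b, ρ.component (K := K) M (β b) where
  toFun m b := ⟨∑ a, x b a • (m a : M),
    Submodule.sum_mem _ fun a _ => ρ.smul_mem_component (hx b a) (m a : M)⟩
  map_add' m m' := by ext b; simp [smul_add, Finset.sum_add_distrib]
  map_smul' k m := by ext b; simp [Finset.smul_sum, smul_comm _ k]

theorem coe_matrixMap {A B : Type*} [Fintype A] {α : A → Y} {β : B → Y} (x : Matrix B A R)
    (hx : ∀ b a, ρ.e (β b) * x b a = x b a) (m : ∀ a, ρ.component (K := K) M (α a)) (b : B) :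
    (ρ.matrixMap M x hx m b : M) = ∑ a, x b a • (m a : M) := rfl

open Classical in
theorem matrixMap_comp_matrixMap {A B : Type*} [Fintype A] [Fintype B] {α : A → Y} {β : B → Y}
    {x : Matrix B A R} {x' : Matrix A B R} (hx : ∀ b a, ρ.e (β b) * x b a = x b a)
    (hx' : ∀ a b, ρ.e (α a) * x' a b = x' a b) (h : x' * x = diagonal (ρ.e ∘ α)) :
    ρ.matrixMap (K := K) M x' hx' ∘ₗ ρ.matrixMap M x hx = LinearMap.id := by
  refine LinearMap.ext fun m => funext fun a => Subtype.ext ?_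
  calc (ρ.matrixMap M x' hx' (ρ.matrixMap M x hx m) a : M)
    _ = ∑ a', (x' * x) a a' • (m a' : M) := by
      simp only [coe_matrixMap, Finset.smul_sum, smul_smul, mul_apply, Finset.sum_smul]
      exact Finset.sum_comm
    _ = m a := by
      rw [h, Finset.sum_eq_single a (fun a' _ ha => by simp [ha.symm]) (by simp)]
      simpa using ρ.mem_component.1 (m a).2

theorem sum_smul_eq (m : M) : ∑ y, ρ.e y • m = m := by
  rw [← Finset.sum_smul, ρ.complete.complete, one_smul]

theorem e_smul_component {y : Y} (m : ρ.component (K := K) M y) : ρ.e y • (m : M) = m :=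
  m.2

theorem e_smul_component_of_ne {y y' : Y} (h : y ≠ y') (m : ρ.component (K := K) M y') :
    ρ.e y • (m : M) = 0 := by
  rw [← ρ.e_smul_component m, smul_smul, ρ.complete.ortho h, zero_smul]

variable (K) in
/-- The projection of an `R`-module onto its component at `y`. -/
def toComponent (y : Y) : M →ₗ[K] ρ.component (K := K) M y :=
  (Algebra.lsmul K K M (ρ.e y)).codRestrict _ (ρ.smul_mem_component (ρ.complete.idem y).eq)

theorem coe_toComponent (y : Y) (m : M) : (ρ.toComponent K y m : M) = ρ.e y • m := rfl

theorem toComponent_coe {y : Y} (m : ρ.component (K := K) M y) : ρ.toComponent K y (m : M) = m :=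
  Subtype.ext (ρ.e_smul_component m)

open Classical in
theorem matrixMap_single {A B : Type*} [Fintype A] {α : A → Y} {β : B → Y} {x : Matrix B A R}
    (hx : ∀ b a, ρ.e (β b) * x b a = x b a) {b : B} {a : A}
    (hx' : x b a * ρ.e (α a) = x b a) (m : M) :
    (ρ.matrixMap M x hx (Pi.single a (ρ.toComponent K (α a) m)) b : M) = x b a • m := by
  rw [coe_matrixMap, Finset.sum_eq_single a (fun a' _ h => by simp [h]) (by simp),
    Pi.single_eq_same, coe_toComponent, smul_smul, hx']

section Glue

variable {N : Type*} [AddCommGroup N] [Module R N] [Module K N] [IsScalarTower K R N]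
  (g : ∀ y, ρ.component (K := K) M y →ₗ[K] ρ.component (K := K) N y)

/-- The linear map `M → N` that restricts to given linear maps of the components. -/
def glue : M →ₗ[K] N := ∑ y, (ρ.component N y).subtype ∘ₗ g y ∘ₗ ρ.toComponent K y

theorem toComponent_glue (y : Y) (m : M) :
    ρ.toComponent K y (ρ.glue g m) = g y (ρ.toComponent K y m) := by
  ext
  simp only [glue, LinearMap.sum_apply, coe_toComponent, Finset.smul_sum, LinearMap.comp_apply,
    Submodule.subtype_apply]
  rw [Finset.sum_eq_single y (fun y' _ h => ρ.e_smul_component_of_ne h.symm _) (by simp),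
    e_smul_component]

theorem glue_coe {y : Y} (m : ρ.component (K := K) M y) : ρ.glue g m = g y m := by
  have h (y') (hy' : y' ≠ y) : ρ.toComponent K y' (m : M) = 0 :=
    Subtype.ext (ρ.e_smul_component_of_ne hy' m)
  simp only [glue, LinearMap.sum_apply, LinearMap.comp_apply, Submodule.subtype_apply]
  rw [Finset.sum_eq_single y (fun y' _ hy' => by simp [h y' hy']) (by simp), toComponent_coe]

theorem glue_smul {A B : Type*} [Fintype A] {α : A → Y} {β : B → Y} {x : Matrix B A R}
    (hx : ∀ b a, ρ.e (β b) * x b a = x b a) (hx' : ∀ b a, x b a * ρ.e (α a) = x b a)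
    (hg : ∀ m, ρ.matrixMap N x hx (fun a => g (α a) (m a)) =
      fun b => g (β b) (ρ.matrixMap M x hx m b)) (b : B) (a : A) (m : M) :
    ρ.glue g (x b a • m) = x b a • ρ.glue g m := by
  classical
  calc ρ.glue g (x b a • m)
    _ = g (β b) (ρ.matrixMap M x hx (Pi.single a (ρ.toComponent K (α a) m)) b) := by
      rw [← glue_coe, matrixMap_single ρ hx (hx' b a)]
    _ = ρ.matrixMap N x hx (Pi.single a (g (α a) (ρ.toComponent K (α a) m))) b := by
      rw [← congrFun (hg _) b]
      congr! 4 with a'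
      exact Pi.apply_single (fun a => g (α a)) (fun a => map_zero _) a _ a'
    _ = x b a • ρ.glue g m := by rw [← toComponent_glue, matrixMap_single ρ hx (hx' b a)]

end Glue

variable (K M) in
/-- The isomorphisms between sums of components given by the matrices `s j` and `t j`. -/
def componentEquiv (j : J) : (∀ a, ρ.component (K := K) M (D.α j a)) ≃ₗ[K]
    ∀ b, ρ.component (K := K) M (D.β j b) :=
  LinearEquiv.ofLinearMap
    (ρ.matrixMap M (ρ.t j) (ρ.e_mul_t j)) (ρ.matrixMap M (ρ.s j) (ρ.e_mul_s j))
    (ρ.matrixMap_comp_matrixMap (ρ.e_mul_s j) (ρ.e_mul_t j) (ρ.t_mul_s j))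
    (ρ.matrixMap_comp_matrixMap (ρ.e_mul_t j) (ρ.e_mul_s j) (ρ.s_mul_t j))

theorem glue_smul_of_mem_entries {N : Type*} [AddCommGroup N] [Module R N] [Module K N]
    [IsScalarTower K R N] (g : ∀ y, ρ.component (K := K) M y →ₗ[K] ρ.component (K := K) N y)
    (hg : ∀ j m, ρ.componentEquiv K N j (fun a => g (D.α j a) (m a)) =
      fun b => g (D.β j b) (ρ.componentEquiv K M j m b)) {x : R} (hx : x ∈ ρ.entries) (m : M) :
    ρ.glue g (x • m) = x • ρ.glue g m := by
  obtain ⟨y, rfl⟩ | ⟨j, a, b, rfl⟩ | ⟨j, b, a, rfl⟩ := hx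
  · rw [← coe_toComponent (K := K), glue_coe, ← toComponent_glue, coe_toComponent]
  · refine ρ.glue_smul g (ρ.e_mul_s j) (ρ.s_mul_e j) (fun m => ?_) a b m
    change (ρ.componentEquiv K N j).symm _ = fun a => g _ ((ρ.componentEquiv K M j).symm m a)
    rw [LinearEquiv.symm_apply_eq, hg, LinearEquiv.apply_symm_apply]
  · exact ρ.glue_smul g (ρ.e_mul_t j) (ρ.t_mul_e j) (hg j) b a m

end Components

section Functor

variable [Field K] [Algebra K R]

open scoped ModuleCat.Algebra

variable (K) in
/-- The functor that sends an `R`-module to its components. -/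
def toRepresentation : ModuleCat.{z} R ⥤ D.Representation K where
  obj M :=
    { obj := fun y => ρ.component (K := K) M y
      iso := ρ.componentEquiv K M }
  map {M N} f := ⟨fun y => ((f.hom.restrictScalars K).restrict fun m hm => by
      have := congrArg f.hom hm
      simpa [mem_component] using this), fun j m => by
      ext b
      simp [componentEquiv, coe_matrixMap]⟩

instance : (ρ.toRepresentation (K := K)).Linear K where
  map_smul _ _ := rfl

theorem toRepresentation_faithful : (ρ.toRepresentation K).Faithful where
  map_injective {_ _ f g} h := by
    ext m
    have h_component (y : Y) : f.hom (ρ.e y • m) = g.hom (ρ.e y • m) :=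
      congrArg Subtype.val (DFunLike.congr_fun (congrFun (congrArg Subtype.val h) y)
        (ρ.toComponent K y m))
    rw [← ρ.sum_smul_eq m, map_sum, map_sum]
    exact Finset.sum_congr rfl fun y _ => h_component y

variable {ρ}

theorem IsUniversal.toRepresentation_full (hρ : IsUniversal.{v} K ρ) :
    (ρ.toRepresentation K).Full where
  map_surjective {M N} g := by
    refine ⟨ModuleCat.ofHom
      { toFun := ρ.glue g.1
        map_add' := map_add _
        map_smul' := map_smul_of_adjoin_eq_top hρ.adjoin_entries _ fun _ =>
          ρ.glue_smul_of_mem_entries g.1 g.2 }, ?_⟩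
    exact Representation.hom_ext fun y => LinearMap.ext fun m => Subtype.ext (ρ.glue_coe g.1 m)

theorem IsUniversal.toRepresentation_essSurj (hρ : IsUniversal.{max u₁ z} K ρ) :
    (ρ.toRepresentation K : ModuleCat.{max u₁ z} R ⥤ _).EssSurj where
  mem_essImage M := by
    classical
    obtain ⟨φ, hφ⟩ := hρ.exists_map_eq _ M.realization
    let _ : Module R (∀ y, M.obj y) := Module.compHom _ (φ : R →+* Module.End K (∀ y, M.obj y))
    have e_smul y (m : ∀ y, M.obj y) : ρ.e y • m = Pi.single y (m y) :=
      LinearMap.congr_fun (congrArg (fun σ => σ.e y) hφ) m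
    have t_smul j b a (m : ∀ y, M.obj y) :
        ρ.t j b a • m = Pi.single (D.β j b) (M.iso j (Pi.single a (m (D.α j a))) b) :=
      LinearMap.congr_fun (congrArg (fun σ => σ.t j b a) hφ) m
    have algebraMap_smul (k : K) (m : ∀ y, M.obj y) : algebraMap K R k • m = k • m :=
      LinearMap.congr_fun (φ.commutes k) m
    let component_equiv (y : Y) :
        ((ρ.toRepresentation K).obj (ModuleCat.of R (∀ y, M.obj y))).obj y ≃ₗ[K] M.obj y :=
      { toFun := fun m => m.1 y
        map_add' := fun _ _ => rfl
        map_smul' := fun k m => congrFun (algebraMap_smul k m.1) y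
        invFun := fun m => ⟨Pi.single y m, (e_smul y _).trans (by simp)⟩
        left_inv := fun m => Subtype.ext ((e_smul y m.1).symm.trans m.2)
        right_inv := fun m => Pi.single_eq_same y m }
    refine ⟨ModuleCat.of R (∀ y, M.obj y), ⟨Representation.isoMk component_equiv fun j m => ?_⟩⟩
    ext b
    calc M.iso j (fun a => (m a).1 (D.α j a)) b
      _ = ∑ a, M.iso j (Pi.single a ((m a).1 (D.α j a))) b := by
        rw [← Finset.sum_apply, ← map_sum, Finset.univ_sum_single]
      _ = (∑ a, ρ.t j b a • (m a).1) (D.β j b) := by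
        simp only [t_smul, Finset.sum_apply, Pi.single_eq_same]

theorem IsUniversal.isEquivalence_toRepresentation (hρ : IsUniversal.{max u₁ z} K ρ) :
    (ρ.toRepresentation K : ModuleCat.{max u₁ z} R ⥤ _).IsEquivalence where
  faithful := ρ.toRepresentation_faithful
  full := hρ.toRepresentation_full
  essSurj := hρ.toRepresentation_essSurj

end Functor

end Realization

section Copies

open Sum

variable {T : Type}

/-- The relations of `E` together with, for every `p : T`, the relation that equates the generator
`p` with the sum `c`, which does not depend on `p`. -/
def adjoinCopies (E : RelationFamily.{u₁, u₂, u₃} (Y ⊕ T) J) {C : Type u₃} [Fintype C]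
    (c : C → Y ⊕ T) : RelationFamily.{u₁, u₂, u₃} (Y ⊕ T) (J ⊕ T) where
  A := Sum.elim E.A fun _ => PUnit
  B := Sum.elim E.B fun _ => C
  fintypeA := Sum.rec E.fintypeA fun _ => inferInstanceAs (Fintype PUnit)
  fintypeB := Sum.rec E.fintypeB fun _ => inferInstanceAs (Fintype C)
  α := Sum.rec E.α fun p _ => inr p
  β := Sum.rec E.β fun _ => c

/-- The family of relations obtained by applying a map to the generators. -/
def mapGenerators {Y' : Type*} (E : RelationFamily.{_, u₂, u₃} Y' J) {Y'' : Type*} (π : Y' → Y'') :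
    RelationFamily.{_, u₂, u₃} Y'' J where
  A := E.A
  B := E.B
  α j := π ∘ E.α j
  β j := π ∘ E.β j

/-- The map that merges all copies of a generator. -/
def mergeCopies : Y ⊕ T → Y ⊕ Unit := Sum.map id fun _ => ()

theorem mergeCopies_surjective [Nonempty T] :
    Function.Surjective (mergeCopies : Y ⊕ T → Y ⊕ Unit) :=
  Sum.map_surjective.2 ⟨Function.surjective_id, Function.surjective_to_subsingleton _⟩

variable {K : Type w} [CommRing K] {E : RelationFamily.{u₁, u₂, u₃} (Y ⊕ T) J} {C : Type u₃}
  [Fintype C] {c : C → Y ⊕ T}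

namespace Representation

variable (K E c) in
/-- The functor that assigns the same module to all copies of a generator. -/
def copyFunctor :
    Representation.{w, u₁, u₂, u₃, z}
      ((E.mapGenerators mergeCopies).adjoinCopies (mergeCopies ∘ c)) K ⥤
    Representation.{w, u₁, u₂, u₃, z} (E.adjoinCopies c) K where
  obj M :=
    { obj := fun y => M.obj (mergeCopies y)
      iso := Sum.rec (fun j => M.iso (inl j)) fun _ => M.iso (inr ()) }
  map f := ⟨fun y => f.1 (mergeCopies y), Sum.rec (fun j => f.2 (inl j)) fun _ => f.2 (inr ())⟩

instance : (copyFunctor K E c).Linear K where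
  map_smul _ _ := rfl

instance copyFunctor_faithful [Nonempty T] : (copyFunctor K E c).Faithful where
  map_injective {_ _ f g} h := by
    have h_copy (y : Y ⊕ T) : f.1 (mergeCopies y) = g.1 (mergeCopies y) :=
      congrFun (congrArg Subtype.val h) y
    exact hom_ext (mergeCopies_surjective.forall.2 h_copy)

theorem copy_eq_of_hom {M N : Representation.{w, u₁, u₂, u₃, z}
    ((E.mapGenerators mergeCopies).adjoinCopies (mergeCopies ∘ c)) K}
    (g : (copyFunctor K E c).obj M ⟶ (copyFunctor K E c).obj N) (p q : T) :
    g.1 (inr p) = g.1 (inr q) := by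
  ext m
  have h : N.iso (inr ()) (fun _ => g.1 (inr p) m) = N.iso (inr ()) (fun _ => g.1 (inr q) m) :=
    (g.2 (inr p) fun _ => m).trans (g.2 (inr q) fun _ => m).symm
  exact congrFun ((N.iso (inr ())).injective h) PUnit.unit

instance copyFunctor_full [Nonempty T] : (copyFunctor K E c).Full where
  map_surjective {M N} g := by
    obtain ⟨t⟩ := ‹Nonempty T›
    let f : ∀ y, M.obj y →ₗ[K] N.obj y := Sum.rec (fun y => g.1 (inl y)) fun _ => g.1 (inr t)
    have f_copy : ∀ y, f (mergeCopies y) = g.1 y := Sum.rec (fun _ => rfl) (copy_eq_of_hom g t)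
    refine ⟨⟨f, Sum.rec (fun j m => ?_) fun _ m => ?_⟩, hom_ext f_copy⟩
    · have h := g.2 (inl j) m
      simp only [← f_copy] at h
      exact h
    · have h := g.2 (inr t) m
      simp only [← f_copy] at h
      exact h

/-- The isomorphism between the modules that a representation assigns to two copies. -/
def copyEquiv (M : (E.adjoinCopies c).Representation K) (p q : T) :
    M.obj (inr p) ≃ₗ[K] M.obj (inr q) :=
  (LinearEquiv.funUnique PUnit K (M.obj (inr p))).symm ≪≫ₗ M.iso (inr p) ≪≫ₗ (M.iso (inr q)).symm
    ≪≫ₗ LinearEquiv.funUnique PUnit K (M.obj (inr q))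

theorem iso_copyEquiv (M : (E.adjoinCopies c).Representation K) (p q : T)
    (m : PUnit → M.obj (inr p)) :
    M.iso (inr q) (fun a => M.copyEquiv p q (m a)) = M.iso (inr p) m :=
  (M.iso (inr q)).apply_symm_apply (M.iso (inr p) m)

instance copyFunctor_essSurj [Nonempty T] : (copyFunctor.{w, u₁, u₂, u₃, z} K E c).EssSurj where
  mem_essImage M := by
    obtain ⟨t⟩ := ‹Nonempty T›
    let τ : ∀ y, M.obj y ≃ₗ[K] M.obj (Sum.map id (fun _ => t) (mergeCopies y)) :=
      Sum.rec (fun y => .refl K _) fun p => M.copyEquiv p t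
    let N : Representation ((E.mapGenerators mergeCopies).adjoinCopies (mergeCopies ∘ c)) K :=
      { obj := fun y => M.obj (Sum.map id (fun _ => t) y)
        iso := Sum.rec
          (fun j => (LinearEquiv.piCongrRight fun a => τ (E.α j a)).symm ≪≫ₗ M.iso (inl j) ≪≫ₗ
            LinearEquiv.piCongrRight fun b => τ (E.β j b))
          fun _ => M.iso (inr t) ≪≫ₗ LinearEquiv.piCongrRight fun b => τ (c b) }
    have τ_comm : ∀ j m, ((copyFunctor K E c).obj N).iso j (fun a => τ _ (m a)) =
        fun b => τ _ (M.iso j m b) :=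
      Sum.rec
        (fun j m => congrArg (fun x b => τ (E.β j b) (M.iso (inl j) x b)) <|
          funext fun a => (τ (E.α j a)).symm_apply_apply (m a))
        fun p m => congrArg (fun (x : ∀ b, M.obj (c b)) b => τ (c b) (x b)) (M.iso_copyEquiv p t m)
    exact ⟨N, ⟨(isoMk (N := (copyFunctor K E c).obj N) τ τ_comm).symm⟩⟩

instance copyFunctor_isEquivalence [Nonempty T] :
    (copyFunctor.{w, u₁, u₂, u₃, z} K E c).IsEquivalence where

end Representation

theorem Realization.IsUniversal.isMoritaEquivalent {K : Type w} [Field K] [Fintype Y] [Fintype T]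
    [Nonempty T] {E : RelationFamily.{u₁, u₂, u₃} (Y ⊕ T) J} {C : Type u₃} [Fintype C]
    {c : C → Y ⊕ T} {R R' : Type (max u₁ z)} [Ring R] [Algebra K R] [Ring R'] [Algebra K R']
    {ρ : (E.adjoinCopies c).Realization R} (hρ : IsUniversal.{max u₁ z} K ρ)
    {ρ' : ((E.mapGenerators mergeCopies).adjoinCopies (mergeCopies ∘ c)).Realization R'}
    (hρ' : IsUniversal.{max u₁ z} K ρ') : IsMoritaEquivalent K R R' := by
  let F : ModuleCat.{max u₁ z} R ⥤ _ := ρ.toRepresentation K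
  let F' : ModuleCat.{max u₁ z} R' ⥤ _ := ρ'.toRepresentation K ⋙ Representation.copyFunctor K E c
  have := hρ.isEquivalence_toRepresentation
  have := hρ'.isEquivalence_toRepresentation
  have : F'.asEquivalence.functor.Linear K :=
    Functor.instLinearComp (ρ'.toRepresentation K) (Representation.copyFunctor K E c)
  have : F'.inv.Linear K := F'.asEquivalence.inverseLinear K
  exact ⟨⟨{
    eqv := F.asEquivalence.trans F'.asEquivalence.symm
    linear := Functor.instLinearComp F F'.inv }⟩⟩

end Copies

end RelationFamily

end Representations

section BergmanAlgebras

open Matrix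

namespace BergmanPresentation

variable {X : Type u} {I : Type v} {P : BergmanPresentation X I} {K : Type w} [Field K]

theorem IsBasic.notMem_blue (hP : P.IsBasic) (i : I) : i ∉ P.blue := fun hi =>
  have ⟨x, hx⟩ := Multiset.exists_mem_of_ne_zero (P.b_ne_zero i)
  hP x i hi hx

theorem IsBasic.slot_eq (hP : P.IsBasic) {x : X} (p : P.Slot x) : p = Slot.base x (hP x) := by
  cases p with
  | base _ _ => rfl
  | blue _ i hi => exact absurd hi (hP.notMem_blue i)

theorem IsBasic.map_univ_idx (hP : P.IsBasic) (c : Multiset X) :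
    Finset.univ.val.map (fun p : P.Idx c => p.1.1) = c := by
  classical
  let _ (x : X) : Unique (P.Slot x) := ⟨⟨.base x (hP x)⟩, hP.slot_eq⟩
  let e : P.Idx c ≃ c.ToType := Equiv.sigmaUnique (Occ c) _
  calc Finset.univ.val.map (fun p : P.Idx c => p.1.1)
    _ = (Finset.univ.val.map e).map Sigma.fst := (Multiset.map_map _ _ _).symm
    _ = c := by
      rw [Multiset.map_univ_val_equiv]
      exact Multiset.map_univ_coe c

theorem IsBasic.epsSum_eq_diagonal (hP : P.IsBasic) (c : Multiset X) [DecidableEq (P.Idx c)] :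
    epsSum K P c = diagonal fun p => epsBase K P p.1.1 (hP _) := by
  ext ⟨o, p⟩ ⟨o', q⟩
  obtain rfl := hP.slot_eq p
  obtain rfl := hP.slot_eq q
  obtain rfl | h := eq_or_ne o o'
  · simp [epsSum, blockDiagonal'_apply, epsBase]
  · simp [epsSum, blockDiagonal'_apply, h]

theorem IsBasic.map_epsSum (hP : P.IsBasic) {R : Type*} [Ring R] [Algebra K R]
    (f : FreeAlgebra K P.Sym →ₐ[K] R) (c : Multiset X) {_ : DecidableEq (P.Idx c)} :
    (epsSum K P c).map f = diagonal fun p => f (epsBase K P p.1.1 (hP _)) := by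
  rw [hP.epsSum_eq_diagonal, diagonal_map (map_zero f)]

theorem IsBasic.map_univ_idx_comp (hP : P.IsBasic) (c : Multiset X) {Z : Type*} (f : X → Z) :
    Finset.univ.val.map (fun p : P.Idx c => f p.1.1) = c.map f :=
  (Multiset.map_map f _ _).symm.trans (congrArg (Multiset.map f) (hP.map_univ_idx c))

variable (P) in
/-- The relations of a presentation. The summands of both sides are indexed by the rows of the
matrices `ε_{a i}` and `ε_{b i}`, which is faithful to the relations only if `P` is basic. -/
noncomputable abbrev relations : RelationFamily X I where
  A i := P.Idx (P.a i)
  B i := P.Idx (P.b i)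
  α _ p := p.1.1
  β _ p := p.1.1

theorem IsBasic.map_epsSum_mul_mul_epsSum (hP : P.IsBasic) {R : Type*} [Ring R] [Algebra K R]
    (f : FreeAlgebra K P.Sym →ₐ[K] R) {c d : Multiset X}
    (m : Matrix (P.Idx c) (P.Idx d) (FreeAlgebra K P.Sym)) (p : P.Idx c) (q : P.Idx d) :
    f ((epsSum K P c * m * epsSum K P d) p q) =
      f (epsBase K P p.1.1 (hP _)) * f (m p q) * f (epsBase K P q.1.1 (hP _)) := by
  classical
  rw [hP.epsSum_eq_diagonal, hP.epsSum_eq_diagonal, mul_diagonal, diagonal_mul, map_mul, map_mul]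

theorem IsBasic.mkAlgHom_epsBase_mul_self (hP : P.IsBasic) (x : X) :
    RingQuot.mkAlgHom K (Rel K P) (epsBase K P x (hP x)) *
      RingQuot.mkAlgHom K (Rel K P) (epsBase K P x (hP x)) =
        RingQuot.mkAlgHom K (Rel K P) (epsBase K P x (hP x)) := by
  rw [← map_mul]
  exact RingQuot.mkAlgHom_rel K (Rel.base_idem (K := K) x (hP x))

variable [Fintype X]

variable (K) in
/-- The realization of the relations of a basic presentation by the matrices that generate its
Bergman algebra. -/
def IsBasic.realization (hP : P.IsBasic) : P.relations.Realization (P.BergmanAlgebra K) where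
  e x := RingQuot.mkAlgHom K (Rel K P) (epsBase K P x (hP x))
  s i := (sigmaMat K P i (hP.notMem_blue i)).map (RingQuot.mkAlgHom K (Rel K P))
  t i := (sigmaMat' K P i (hP.notMem_blue i)).map (RingQuot.mkAlgHom K (Rel K P))
  complete :=
    { idem := hP.mkAlgHom_epsBase_mul_self
      ortho := fun x y hxy => by
        have h := RingQuot.mkAlgHom_rel K (Rel.base_orth (K := K) x y (hP x) (hP y) hxy)
        rwa [map_mul, map_zero] at h
      complete := by
        have h := RingQuot.mkAlgHom_rel K (Rel.base_sum (K := K) (P := P))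
        rw [map_sum, map_one] at h
        rw [← h]
        exact (Fintype.sum_equiv (Equiv.subtypeUnivEquiv hP) _ _ fun _ => rfl).symm }
  e_mul_s i p q := by
    simp only [map_apply]
    rw [← RingQuot.mkAlgHom_rel K (Rel.red_sigma i (hP.notMem_blue i) p q),
      hP.map_epsSum_mul_mul_epsSum, mul_assoc, ← mul_assoc, hP.mkAlgHom_epsBase_mul_self]
  s_mul_e i p q := by
    simp only [map_apply]
    rw [← RingQuot.mkAlgHom_rel K (Rel.red_sigma i (hP.notMem_blue i) p q),
      hP.map_epsSum_mul_mul_epsSum, mul_assoc, hP.mkAlgHom_epsBase_mul_self]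
  e_mul_t i q p := by
    simp only [map_apply]
    rw [← RingQuot.mkAlgHom_rel K (Rel.red_sigma' i (hP.notMem_blue i) q p),
      hP.map_epsSum_mul_mul_epsSum, mul_assoc, ← mul_assoc, hP.mkAlgHom_epsBase_mul_self]
  t_mul_e i q p := by
    simp only [map_apply]
    rw [← RingQuot.mkAlgHom_rel K (Rel.red_sigma' i (hP.notMem_blue i) q p),
      hP.map_epsSum_mul_mul_epsSum, mul_assoc, hP.mkAlgHom_epsBase_mul_self]
  s_mul_t i := by
    rw [← Matrix.map_mul]
    exact (Matrix.ext fun p q => RingQuot.mkAlgHom_rel K (Rel.red_left i _ p q)).trans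
      (hP.map_epsSum _ _)
  t_mul_s i := by
    rw [← Matrix.map_mul]
    exact (Matrix.ext fun p q => RingQuot.mkAlgHom_rel K (Rel.red_right i _ p q)).trans
      (hP.map_epsSum _ _)

/-- The homomorphism from the free algebra that sends the symbols to the entries of a realization
of the relations. -/
noncomputable def liftSym {R : Type*} [Ring R] [Algebra K R] (σ : P.relations.Realization R) :
    FreeAlgebra K P.Sym →ₐ[K] R :=
  FreeAlgebra.lift K fun
    | .eps x _ _ => σ.e x
    | .sigma i _ p q => σ.s i p q
    | .sigma' i _ q p => σ.t i q p

section

variable {R : Type*} [Ring R] [Algebra K R] (σ : P.relations.Realization R)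

theorem liftSym_epsBase (x : X) (hx : P.IsBase x) :
    liftSym σ (epsBase K P x hx) = σ.e x := FreeAlgebra.lift_ι_apply _ _

theorem map_liftSym_sigmaMat (i : I) (hi : i ∉ P.blue) :
    (sigmaMat K P i hi).map (liftSym σ) = σ.s i :=
  Matrix.ext fun _ _ => FreeAlgebra.lift_ι_apply _ _

theorem map_liftSym_sigmaMat' (i : I) (hi : i ∉ P.blue) :
    (sigmaMat' K P i hi).map (liftSym σ) = σ.t i :=
  Matrix.ext fun _ _ => FreeAlgebra.lift_ι_apply _ _

theorem IsBasic.map_liftSym_epsSum (hP : P.IsBasic) (c : Multiset X) {_ : DecidableEq (P.Idx c)} :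
    (epsSum K P c).map (liftSym σ) = diagonal fun p => σ.e p.1.1 :=
  (hP.map_epsSum _ c).trans (congrArg diagonal (funext fun _ => liftSym_epsBase σ _ _))

theorem IsBasic.liftSym_eq_of_rel (hP : P.IsBasic) ⦃x y : FreeAlgebra K P.Sym⦄ (h : Rel K P x y) :
    liftSym σ x = liftSym σ y := by
  classical
  have map_apply {m n : Type _} (M : Matrix m n (FreeAlgebra K P.Sym)) (p q) :
      liftSym σ (M p q) = M.map (liftSym σ) p q := rfl
  cases h with
  | base_idem x hx => rw [map_mul, liftSym_epsBase, σ.complete.idem x]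
  | base_orth x y hx hy hxy =>
    rw [map_mul, liftSym_epsBase, liftSym_epsBase, map_zero, σ.complete.ortho hxy]
  | base_sum =>
    simp_rw [map_sum, map_one, liftSym_epsBase, ← σ.complete.complete]
    exact Fintype.sum_equiv (Equiv.subtypeUnivEquiv hP) _ _ fun _ => rfl
  | red_sigma i hi p q =>
    rw [map_apply, map_apply, Matrix.map_mul, Matrix.map_mul, hP.map_liftSym_epsSum,
      hP.map_liftSym_epsSum, map_liftSym_sigmaMat, mul_diagonal, diagonal_mul]
    rw [σ.e_mul_s i p q, σ.s_mul_e i p q]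
  | red_sigma' i hi q p =>
    rw [map_apply, map_apply, Matrix.map_mul, Matrix.map_mul, hP.map_liftSym_epsSum,
      hP.map_liftSym_epsSum, map_liftSym_sigmaMat', mul_diagonal, diagonal_mul]
    rw [σ.e_mul_t i q p, σ.t_mul_e i q p]
  | red_left i hi p p' =>
    rw [map_apply, map_apply, Matrix.map_mul, map_liftSym_sigmaMat, map_liftSym_sigmaMat']
    exact congrFun₂ ((σ.s_mul_t i).trans (hP.map_liftSym_epsSum σ _).symm) p p'
  | red_right i hi q q' =>
    rw [map_apply, map_apply, Matrix.map_mul, map_liftSym_sigmaMat, map_liftSym_sigmaMat']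
    exact congrFun₂ ((σ.t_mul_s i).trans (hP.map_liftSym_epsSum σ _).symm) q q'
  | _ i hi => exact absurd hi (hP.notMem_blue i)

end

theorem IsBasic.isUniversal_realization (hP : P.IsBasic) : (hP.realization K).IsUniversal K where
  exists_map_eq S _ _ σ := by
    refine ⟨RingQuot.liftAlgHom K ⟨liftSym σ, hP.liftSym_eq_of_rel σ⟩, ?_⟩
    have lift_mkAlgHom (x) := RingQuot.liftAlgHom_mkAlgHom_apply (S := K) (liftSym σ)
      (hP.liftSym_eq_of_rel σ) x
    ext
    · exact (lift_mkAlgHom _).trans (liftSym_epsBase σ _ _)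
    · exact (lift_mkAlgHom _).trans (congrFun₂ (map_liftSym_sigmaMat σ _ _) _ _)
    · exact (lift_mkAlgHom _).trans (congrFun₂ (map_liftSym_sigmaMat' σ _ _) _ _)
  adjoin_entries := by
    have adjoin_range : Algebra.adjoin K (Set.range fun x =>
        RingQuot.mkAlgHom K (Rel K P) (FreeAlgebra.ι K x)) = ⊤ := by
      rw [Set.range_comp', ← AlgHom.map_adjoin, FreeAlgebra.adjoin_range_ι, Algebra.map_top]
      exact (AlgHom.range_eq_top _).2 (RingQuot.mkAlgHom_surjective K _)
    refine top_unique (adjoin_range.ge.trans (Algebra.adjoin_mono ?_))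
    rintro _ ⟨⟨x, p, q⟩ | ⟨i, hi, p, q⟩ | ⟨i, hi, q, p⟩, rfl⟩
    · obtain rfl := hP.slot_eq p
      obtain rfl := hP.slot_eq q
      exact .inl ⟨x, rfl⟩
    · exact .inr (.inl ⟨i, p, q, rfl⟩)
    · exact .inr (.inr ⟨i, q, p, rfl⟩)

end BergmanPresentation

end BergmanAlgebras

section Splittings

open Sum

universe u₁ u₂ u₃

/-- The type `Y` as the set of the elements other than `y₁`, with `y₁` added. -/
noncomputable def neSumUnitEquiv {Y : Type*} (y₁ : Y) : {y // y ≠ y₁} ⊕ Unit ≃ Y :=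
  open scoped Classical in
  (Equiv.optionEquivSumPUnit _).symm.trans (Equiv.optionSubtypeNe y₁)

theorem neSumUnitEquiv_inl {Y : Type*} {y₁ : Y} (y : {y // y ≠ y₁}) :
    neSumUnitEquiv y₁ (inl y) = y := by simp [neSumUnitEquiv]

theorem neSumUnitEquiv_inr {Y : Type*} {y₁ : Y} (p : Unit) :
    neSumUnitEquiv y₁ (inr p) = y₁ := by simp [neSumUnitEquiv]

/-- The map that sends all copies of `y₁` back to `y₁`, where `e` describes `Z` as the set obtained
from `Y` by replacing `y₁` by the copies in `T`. -/
def collapse {Y Z T : Type*} {y₁ : Y} (e : {y // y ≠ y₁} ⊕ T ≃ Z) : Z → Y :=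
  Sum.elim Subtype.val (fun _ => y₁) ∘ e.symm

namespace BergmanPresentation

variable {X X' : Type u} {I I' : Type v} {T : Type} {P : BergmanPresentation X I}
  {P' : BergmanPresentation X' I'}

theorem IsBasic.nonempty_iso_adjoinCopies {Y : Type u₁} {J : Type u₂} (hP : P.IsBasic)
    {E : RelationFamily.{u₁, u₂, u₃} (Y ⊕ T) J} {C : Type u₃} [Fintype C] {c : C → Y ⊕ T}
    (gen : Y ⊕ T ≃ X) (rel : J ⊕ T ≃ I)
    (left : ∀ j, (Finset.univ.val.map (E.α j)).map gen = P.a (rel (inl j)))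
    (right : ∀ j, (Finset.univ.val.map (E.β j)).map gen = P.b (rel (inl j)))
    (left_copy : ∀ p, P.a (rel (inr p)) = {gen (inr p)})
    (right_copy : ∀ p, (Finset.univ.val.map c).map gen = P.b (rel (inr p))) :
    Nonempty ((E.adjoinCopies c).Iso P.relations) :=
  RelationFamily.Iso.nonempty_of_map_eq gen rel
    (Sum.rec (fun j => (left j).trans (hP.map_univ_idx _).symm) fun p =>
      (left_copy p).symm.trans (hP.map_univ_idx _).symm)
    (Sum.rec (fun j => (right j).trans (hP.map_univ_idx _).symm) fun p =>
      (right_copy p).trans (hP.map_univ_idx _).symm)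

/-- A way in which `P'` arises from `P` by replacing a generator `x₁`, the left-hand side of the
relation `i₁`, by copies of it indexed by `T`. Every copy is equated with the same sum `c`, and the
relations of `P` are recovered when the copies are identified. -/
structure Splitting (P : BergmanPresentation X I) (P' : BergmanPresentation X' I')
    (T : Type) where
  x₁ : X
  i₁ : I
  generator : {x // x ≠ x₁} ⊕ T ≃ X'
  relation : {i // i ≠ i₁} ⊕ T ≃ I'
  c : Multiset X'
  a_i₁ : P.a i₁ = {x₁}
  map_c : c.map (collapse generator) = P.b i₁
  map_a : ∀ j, (P'.a (relation (inl j))).map (collapse generator) = P.a j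
  map_b : ∀ j, (P'.b (relation (inl j))).map (collapse generator) = P.b j
  a_copy : ∀ p, P'.a (relation (inr p)) = {generator (inr p)}
  b_copy : ∀ p, P'.b (relation (inr p)) = c

namespace Splitting

variable (σ : P.Splitting P' T)

/-- The relations of `P'` other than those that define the copies of the generator. -/
noncomputable def commonRelations :
    RelationFamily ({x // x ≠ σ.x₁} ⊕ T) {i // i ≠ σ.i₁} where
  A j := P'.Idx (P'.a (σ.relation (inl j)))
  B j := P'.Idx (P'.b (σ.relation (inl j)))
  α _ p := σ.generator.symm p.1.1
  β _ p := σ.generator.symm p.1.1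

/-- The summands of the common right-hand side of the relations that define the copies. -/
def copySummand (p : P'.Idx σ.c) : {x // x ≠ σ.x₁} ⊕ T := σ.generator.symm p.1.1

theorem neSumUnitEquiv_mergeCopies (x : {x // x ≠ σ.x₁} ⊕ T) :
    neSumUnitEquiv σ.x₁ (RelationFamily.mergeCopies x) = Sum.elim Subtype.val (fun _ => σ.x₁) x :=
  x.rec neSumUnitEquiv_inl fun _ => neSumUnitEquiv_inr ()

theorem nonempty_iso_split (hP' : P'.IsBasic) :
    Nonempty ((σ.commonRelations.adjoinCopies σ.copySummand).Iso P'.relations) := by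
  have map_generator (m : Multiset X') :
      (Finset.univ.val.map fun p : P'.Idx m => σ.generator.symm p.1.1).map σ.generator = m := by
    simp [hP'.map_univ_idx_comp]
  exact hP'.nonempty_iso_adjoinCopies σ.generator σ.relation (fun j => map_generator _)
    (fun j => map_generator _) σ.a_copy fun p => (map_generator _).trans (σ.b_copy p).symm

theorem nonempty_iso_merge (hP : P.IsBasic) (hP' : P'.IsBasic) :
    Nonempty (((σ.commonRelations.mapGenerators RelationFamily.mergeCopies).adjoinCopies
      (RelationFamily.mergeCopies ∘ σ.copySummand)).Iso P.relations) := by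
  have map_merge (m : Multiset X') :
      (Finset.univ.val.map fun p : P'.Idx m =>
        RelationFamily.mergeCopies (σ.generator.symm p.1.1)).map (neSumUnitEquiv σ.x₁) =
          m.map (collapse σ.generator) := by
    rw [hP'.map_univ_idx_comp m fun x => RelationFamily.mergeCopies (σ.generator.symm x),
      Multiset.map_map]
    exact Multiset.map_congr rfl fun x _ => σ.neSumUnitEquiv_mergeCopies _
  refine hP.nonempty_iso_adjoinCopies (neSumUnitEquiv σ.x₁) (neSumUnitEquiv σ.i₁)
    (fun j => ?_) (fun j => ?_) (fun p => ?_) fun p => ?_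
  · rw [neSumUnitEquiv_inl, ← σ.map_a]
    exact map_merge _
  · rw [neSumUnitEquiv_inl, ← σ.map_b]
    exact map_merge _
  · rw [neSumUnitEquiv_inr, neSumUnitEquiv_inr, σ.a_i₁]
  · rw [neSumUnitEquiv_inr, ← σ.map_c]
    exact map_merge _

end Splitting

end BergmanPresentation

end Splittings

section Insplittings

open Sum

section

variable {Y Z : Type*} {n : ℕ} {y₁ : Y}

theorem collapse_inl {T : Type*} (e : {y // y ≠ y₁} ⊕ T ≃ Z) (y : {y // y ≠ y₁}) :
    collapse e (e (inl y)) = y := by simp [collapse]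

theorem collapse_inr {T : Type*} (e : {y // y ≠ y₁} ⊕ T ≃ Z) (p : T) :
    collapse e (e (inr p)) = y₁ := by simp [collapse]

/-- The set obtained from `Y` by adding `n` elements, as the set obtained from `Y` by replacing `y₁`
by `n + 1` copies; the copy `0` is `y₁`. -/
noncomputable def copiesEquiv (y₁ : Y) (e : Y ⊕ Fin n ≃ Z) : {y // y ≠ y₁} ⊕ Fin (n + 1) ≃ Z :=
  calc {y // y ≠ y₁} ⊕ Fin (n + 1)
    _ ≃ {y // y ≠ y₁} ⊕ (Unit ⊕ Fin n) := (Equiv.refl _).sumCongr <|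
      (finSuccEquiv n).trans <| (Equiv.optionEquivSumPUnit _).trans (Equiv.sumComm _ _)
    _ ≃ ({y // y ≠ y₁} ⊕ Unit) ⊕ Fin n := (Equiv.sumAssoc _ _ _).symm
    _ ≃ Y ⊕ Fin n := (neSumUnitEquiv y₁).sumCongr (Equiv.refl _)
    _ ≃ Z := e

theorem copiesEquiv_inl (e : Y ⊕ Fin n ≃ Z) (y : {y // y ≠ y₁}) :
    copiesEquiv y₁ e (inl y) = e (inl y) :=
  congrArg (e ∘ inl) (neSumUnitEquiv_inl y)

theorem copiesEquiv_comp_inr (e : Y ⊕ Fin n ≃ Z) :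
    copiesEquiv y₁ e ∘ inr = Fin.cons (e (inl y₁)) fun q => e (inr q) :=
  funext <| Fin.cases (congrArg (e ∘ inl) (neSumUnitEquiv_inr ())) fun q => by
    simp [copiesEquiv, Trans.trans]

theorem collapse_copiesEquiv_old (e : Y ⊕ Fin n ≃ Z) (y : Y) :
    collapse (copiesEquiv y₁ e) (e (inl y)) = y := by
  obtain rfl | h := eq_or_ne y y₁
  · exact (congrArg _ (congrFun (copiesEquiv_comp_inr e) 0).symm).trans (collapse_inr _ 0)
  · exact (congrArg _ (copiesEquiv_inl e ⟨y, h⟩).symm).trans (collapse_inl _ ⟨y, h⟩)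

end

namespace BergmanPresentation

variable {X X' : Type u} {I I' : Type v} {P : BergmanPresentation X I}
  {P' : BergmanPresentation X' I'}

open Classical in
theorem map_splitSum {n : ℕ} {x₁ : X} {old : X → X'} {gen : Fin n → X'} {f : X' → X}
    (f_old : ∀ x, f (old x) = x) (f_gen : ∀ p, f (gen p) = x₁) (c : Multiset X)
    (φ : Fin (c.count x₁) → Fin n) : (splitSum x₁ old gen c φ).map f = c := by
  have map_copies : (∑ k, ({gen (φ k)} : Multiset X')).map f = c.filter (x₁ = ·) := by
    rw [← Multiset.coe_mapAddMonoidHom, map_sum]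
    simp [f_gen, Multiset.filter_eq, Multiset.nsmul_singleton]
  rw [splitSum, Multiset.map_add, Multiset.map_map, map_copies, add_comm]
  simpa [Function.comp_def, f_old, eq_comm] using Multiset.filter_add_not (x₁ = ·) c

theorem IsInsplitting.exists_splitting (h : P.IsInsplitting P') :
    ∃ n, Nonempty (P.Splitting P' (Fin (n + 1))) := by
  obtain ⟨-, -, x₁, i, n, φ, eX, eI, ha, -, -, h_old, h_copy⟩ := h
  simp only [← copiesEquiv_comp_inr] at h_old h_copy
  have map_splitSum (c : Multiset X) (φ) := map_splitSum (collapse_copiesEquiv_old (y₁ := x₁) eX)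
    (collapse_inr (copiesEquiv x₁ eX)) c φ
  exact ⟨n, ⟨{
    x₁ := x₁
    i₁ := i
    generator := copiesEquiv x₁ eX
    relation := copiesEquiv i eI
    c := _
    a_i₁ := ha
    map_c := map_splitSum _ _
    map_a := fun j => by
      rw [copiesEquiv_inl, (h_old j j.2).1, Multiset.map_map]
      simp [collapse_copiesEquiv_old]
    map_b := fun j => by
      rw [copiesEquiv_inl, (h_old j j.2).2]
      exact map_splitSum _ _
    a_copy := fun p => (h_copy p).1
    b_copy := fun p => (h_copy p).2 }⟩⟩

end BergmanPresentation

namespace BergmanGraph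

variable {V V' : Type u} {E E' : Type v} {H : BergmanGraph V E} {H' : BergmanGraph V' E'}

theorem formalSum_eq_sum [Fintype V] (m : V → ℕ) :
    formalSum m = ∑ v, m v • ({v} : Multiset V) := by
  rw [formalSum]
  congr!

theorem formalSum_single [Finite V] [DecidableEq V] (v : V) :
    formalSum (Pi.single v 1) = {v} := by
  have := Fintype.ofFinite V
  rw [formalSum_eq_sum, Finset.sum_eq_single v (fun u _ h => by simp [h]) (by simp)]
  simp

theorem map_collapse_formalSum {T : Type*} [Finite V] [Finite V'] [Fintype T] {v₁ : V}
    (e : {v // v ≠ v₁} ⊕ T ≃ V') {m : V → ℕ} {m' : V' → ℕ}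
    (h_old : ∀ v, m' (e (inl v)) = m v) (h_copy : ∑ p, m' (e (inr p)) = m v₁) :
    (formalSum m').map (collapse e) = formalSum m := by
  have := Fintype.ofFinite V
  have := Fintype.ofFinite V'
  have := Fintype.ofFinite {v // v ≠ v₁}
  calc (formalSum m').map (collapse e)
    _ = ∑ v, m' v • {collapse e v} := by
      rw [formalSum_eq_sum, ← Multiset.coe_mapAddMonoidHom, map_sum]
      simp [Multiset.map_nsmul]
    _ = ∑ v : {v // v ≠ v₁}, m v • {v.1} + m v₁ • {v₁} := by
      simp only [← e.sum_comp, Fintype.sum_sum_type, collapse_inl, collapse_inr, h_old,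
        ← Finset.sum_smul, h_copy]
    _ = formalSum m := by
      rw [formalSum_eq_sum, ← (neSumUnitEquiv v₁).sum_comp]
      simp [neSumUnitEquiv_inl, neSumUnitEquiv_inr]

theorem IsBasic.toPresentation (hH : H.IsBasic) : H.toPresentation.IsBasic := fun v h hh hv =>
  hH v h hh ((@mem_formalSum _ H.finite_vertices _ _).1 hv)

theorem IsInsplitting.exists_splitting (h : H.IsInsplitting H') :
    ∃ n, Nonempty (H.toPresentation.Splitting H'.toPresentation (Fin (n + 1))) := by
  classical
  obtain ⟨-, -, v₁, h₁, n, φ, eV, eE, hs, hs₁, -, h_old, h_copy⟩ := h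
  have := H.finite_vertices
  have := H'.finite_vertices
  simp only [← copiesEquiv_comp_inr, Function.comp_apply] at h_old h_copy
  have sum_card (g : E) : ∑ q, Nat.card {k : Fin (H.r g v₁) // φ ⟨g, k⟩ = q} = H.r g v₁ := by
    rw [← Nat.card_sigma, Nat.card_congr (Equiv.sigmaFiberEquiv _), Nat.card_fin]
  have map_range {g : E} {m' : V' → ℕ} (h_ne : ∀ u ≠ v₁, m' (eV (inl u)) = H.r g u)
      (h_inr : ∀ q, m' (copiesEquiv v₁ eV (inr q)) =
        Nat.card {k : Fin (H.r g v₁) // φ ⟨g, k⟩ = q}) :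
      (formalSum m').map (collapse (copiesEquiv v₁ eV)) = formalSum (H.r g) :=
    map_collapse_formalSum _ (fun u => (congrArg m' (copiesEquiv_inl eV u)).trans (h_ne u u.2))
      ((Finset.sum_congr rfl fun q _ => h_inr q).trans (sum_card g))
  have range_copy (p q : Fin (n + 1)) :
      H'.r (copiesEquiv h₁ eE (inr p)) = H'.r (copiesEquiv h₁ eE (inr q)) := by
    refine funext fun v => ?_
    obtain ⟨u | t, rfl⟩ := (copiesEquiv v₁ eV).surjective v
    · rw [copiesEquiv_inl, (h_copy p).2.1 u u.2, (h_copy q).2.1 u u.2]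
    · rw [(h_copy p).2.2, (h_copy q).2.2]
  exact ⟨n, ⟨{
    x₁ := v₁
    i₁ := h₁
    generator := copiesEquiv v₁ eV
    relation := copiesEquiv h₁ eE
    c := formalSum (H'.r (copiesEquiv h₁ eE (inr 0)))
    a_i₁ := (congrArg formalSum hs).trans (formalSum_single v₁)
    map_c := map_range (h_copy 0).2.1 (h_copy 0).2.2
    map_a := fun g => by
      rw [copiesEquiv_inl]
      refine map_collapse_formalSum _ (fun u => ?_) ?_
      · rw [copiesEquiv_inl]
        exact (h_old g g.2).1 u
      · simp only [(h_old g g.2).2.1, hs₁ g g.2, Finset.sum_const_zero]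
    map_b := fun g => by
      rw [copiesEquiv_inl]
      exact map_range (h_old g g.2).2.2.1 (h_old g g.2).2.2.2
    a_copy := fun p => (congrArg formalSum (h_copy p).1).trans (formalSum_single _)
    b_copy := fun p => congrArg formalSum (range_copy p 0) }⟩⟩

end BergmanGraph

end Insplittings

theorem mainTheorem3_general (K : Type w) [Field K] {X X' : Type u} {I I' : Type v}
    {P : BergmanPresentation X I} {P' : BergmanPresentation X' I'} {T : Type} [Finite T]
    [Nonempty T] (hP : P.IsBasic) (hP' : P'.IsBasic) (σ : P.Splitting P' T) :
    IsMoritaEquivalent K (P'.BergmanAlgebra K) (P.BergmanAlgebra K) := by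
  have := P.finite_generators
  have := Fintype.ofFinite X
  have := P'.finite_generators
  have := Fintype.ofFinite X'
  have := Fintype.ofFinite T
  have := Fintype.ofFinite {x // x ≠ σ.x₁}
  obtain ⟨f'⟩ := σ.nonempty_iso_split hP'
  obtain ⟨f⟩ := σ.nonempty_iso_merge hP hP'
  exact RelationFamily.Realization.IsUniversal.isMoritaEquivalent.{w, u, v, max u v, max u v w}
    (hP'.isUniversal_realization.comap f') (hP.isUniversal_realization.comap f)

theorem mainTheorem3 (K : Type w) [Field K] :
    (∀ (X X' : Type u) (I I' : Type v) (P : BergmanPresentation X I)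
      (P' : BergmanPresentation X' I'), P.IsBasic → P.IsInsplitting P' →
        IsMoritaEquivalent K (P'.BergmanAlgebra K) (P.BergmanAlgebra K)) ∧
    (∀ (V V' : Type u) (E E' : Type v) (H : BergmanGraph V E) (H' : BergmanGraph V' E'),
      H.IsBasic → H.IsInsplitting H' →
        IsMoritaEquivalent K (H'.BergmanAlgebra K) (H.BergmanAlgebra K)) :=
  ⟨fun _ _ _ _ _ _ hP h =>
    have ⟨_, ⟨σ⟩⟩ := h.exists_splitting
    mainTheorem3_general K hP h.2.1 σ,
  fun _ _ _ _ _ _ hH h =>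
    have ⟨_, ⟨σ⟩⟩ := h.exists_splitting
    mainTheorem3_general K hH.toPresentation h.2.1.toPresentation σ⟩
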